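/- Let $C$ be a compact Riemann surface and $E\to C$ a smooth complex vector bundle of rank $n$. Let $(\bar\partial_E,\varphi,h)$ be a solution of Hitchin's equations: $\bar\partial_E$ is a holomorphic structure on $E$, $\varphi\in\Omega^{1,0}(C,\mathrm{End}\,E)$ is traceless with $\bar\partial_E\varphi=0$, and $h$ is a smooth hermitian metric on $E$ with $F_{D(\bar\partial_E,h)}+[\varphi,\varphi^{\dagger_h}]=0$, where $D(\bar\partial_E,h)$ is the Chern connection, with $(1,0)$-part $\partial_E^h$, and brackets of $\mathrm{End}\,E$-valued forms are graded commutators. Let $(\dot\eta,\dot\varphi)\in\Omega^{0,1}(\mathfrak{sl}(E))\oplus\Omega^{1,0}(\mathfrak{sl}(E))$ be smooth with $\bar\partial_E\dot\varphi+[\dot\eta,\varphi]=0$, and let $\dot\nu\in\Omega^0(\mathfrak{sl}(E))$ be a smooth solution of $$\partial_E^h\bar\partial_E\dot\nu-\partial_E^h\dot\eta-\big[\varphi^{\dagger_h},\dot\varphi+[\dot\nu,\varphi]\big]=0.$$ For a hermitian metric $k$ on $E$ put $\langle\alpha,\beta\rangle_k=\mathrm{tr}(\alpha\wedge\bar\star\beta^{\dagger_k})$,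 a $2$-form; here for $\beta=\beta_z\,dz+\beta_{\bar z}\,d\bar z$ one has $\bar\star\beta^{\dagger_k}=i\beta_z^{\dagger_k}d\bar z-i\beta_{\bar z}^{\dagger_k}dz$. Let $h_0$ be any smooth hermitian metric on $E$, let $H$ be the $h_0$-hermitian positive section of $\mathrm{End}\,E$ with $h(v,w)=h_0(Hv,w)$, and set $\bar\partial_A=H^{1/2}\circ\bar\partial_E\circ H^{-1/2}$, $\Phi=H^{1/2}\varphi H^{-1/2}$. The unitary deformation associated with $(\dot\eta,\dot\varphi,\dot\nu)$ is $$\dot A^{0,1}=H^{1/2}(\dot\eta-\bar\partial_E\dot\nu)H^{-1/2},\qquad \dot\Phi=H^{1/2}(\dot\varphi+[\dot\nu,\varphi])H^{-1/2}.$$ On $\Omega^{0,1}(\mathfrak{sl}(E))\oplus\Omega^{1,0}(\mathfrak{sl}(E))$ let $g\big((a_1,b_1),(a_2,b_2)\big)=2\,\mathrm{Re}\int_C\langle a_1,a_2\rangle_{h_0}+\langle b_1,b_2\rangle_{h_0}$, and let $\rho(\gamma)=(-\bar\partial_A\gamma,[\gamma,\Phi])$ for $\gamma\in\Omega^0(\mathfrak{su}(E,h_0))$.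 Hitchin's hyperkähler metric is $\|(\dot\eta,\dot\varphi,\dot\nu)\|^2_{g_{L^2}}=\|(\dot A^{0,1},\dot\Phi)^\perp\|_g^2$, where $(\dot A^{0,1},\dot\Phi)^\perp$ is the component of $(\dot A^{0,1},\dot\Phi)$ that is $g$-perpendicular to the image of $\rho$. Then $(\dot A^{0,1},\dot\Phi)$ is in Coulomb gauge, that is, $g$-perpendicular to the image of $\rho$, and $$\|(\dot\eta,\dot\varphi,\dot\nu)\|^2_{g_{L^2}}=2\int_C\langle\dot\eta-\bar\partial_E\dot\nu,\dot\eta\rangle_h+\langle\dot\varphi+[\dot\nu,\varphi],\dot\varphi\rangle_h .$$ In particular the right-hand side is real and the background metric $h_0$ does not appear in it. -/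

import Mathlib

open scoped Manifold ContDiff Matrix ComplexOrder

noncomputable section

namespace HitchinMetric

/-- `n × n` complex matrices. -/
abbrev Mat (n : ℕ) : Type := Matrix (Fin n) (Fin n) ℂ

/-! ### Local calculus in a holomorphic coordinate `z` -/

/-- The Wirtinger derivative `∂f/∂z = (∂f/∂x - i ∂f/∂y) / 2`. -/
def wirtDz (f : ℂ → ℂ) (z : ℂ) : ℂ :=
  (fderiv ℝ f z 1 - Complex.I * fderiv ℝ f z Complex.I) / 2

/-- The Wirtinger derivative `∂f/∂z̄ = (∂f/∂x + i ∂f/∂y) / 2`. -/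
def wirtDzbar (f : ℂ → ℂ) (z : ℂ) : ℂ :=
  (fderiv ℝ f z 1 + Complex.I * fderiv ℝ f z Complex.I) / 2

variable {n : ℕ}

/-- Entrywise `∂/∂z` of a matrix function. -/
def matDz (A : ℂ → Mat n) (z : ℂ) : Mat n :=
  Matrix.of fun a b => wirtDz (fun w => A w a b) z

/-- Entrywise `∂/∂z̄` of a matrix function. -/
def matDzbar (A : ℂ → Mat n) (z : ℂ) : Mat n :=
  Matrix.of fun a b => wirtDzbar (fun w => A w a b) z

/-- The commutator of two endomorphisms. -/
def comm (X Y : Mat n) : Mat n := X * Y - Y * X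

/-- The adjoint of the endomorphism `X` for the hermitian form `h(v, w) = wᴴ h v`, that is
`h(X v, w) = h(v, X† w)`. -/
def adj (h X : Mat n) : Mat n := h⁻¹ * Xᴴ * h

/-- The coefficient of `dz ∧ dz̄` in the graded commutator
`[P dz, Q dz̄] = P dz ∧ Q dz̄ + Q dz̄ ∧ P dz`. -/
def bracket1001 (P Q : Mat n) : Mat n := P * Q - Q * P

/-- The coefficient of `dz ∧ dz̄` in the graded commutator
`[Q dz̄, P dz] = Q dz̄ ∧ P dz + P dz ∧ Q dz̄`. -/
def bracket0110 (Q P : Mat n) : Mat n := P * Q - Q * P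

/-- With `∂̄_E = ∂̄ + α dz̄` in a frame, the coefficient of `dz̄` in `∂̄_E X`, for a section `X` of
`End E`. -/
def dbarEnd (α X : ℂ → Mat n) (z : ℂ) : Mat n :=
  matDzbar X z + comm (α z) (X z)

/-- With `∂̄_E = ∂̄ + α dz̄` in a frame, the coefficient of `dz ∧ dz̄` in `∂̄_E (P dz)`. -/
def dbarForm10 (α P : ℂ → Mat n) (z : ℂ) : Mat n :=
  -(matDzbar P z + comm (α z) (P z))

/-- The Chern connection of `∂̄_E = ∂̄ + α dz̄` and `h` is `d + β dz + α dz̄` with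
`∂h/∂z = h β + αᴴ h`; this is `β`. -/
def chern10 (α h : ℂ → Mat n) (z : ℂ) : Mat n :=
  (h z)⁻¹ * (matDz h z - (α z)ᴴ * h z)

/-- The coefficient of `dz ∧ dz̄` in `∂_E^h (Q dz̄)`, where `∂_E^h` is the `(1,0)`-part of the Chern
connection, acting on `End E`-valued forms. -/
def delForm01 (α h Q : ℂ → Mat n) (z : ℂ) : Mat n :=
  matDz Q z + comm (chern10 α h z) (Q z)

/-- The coefficient of `dz ∧ dz̄` in the curvature of the Chern connection `d + β dz + α dz̄`. -/
def chernCurvature (α h : ℂ → Mat n) (z : ℂ) : Mat n :=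
  matDz α z - matDzbar (chern10 α h) z + comm (chern10 α h z) (α z)

/-- The coefficient of `dz ∧ dz̄` in `⟨Q₁ dz̄, Q₂ dz̄⟩_h = tr (Q₁ dz̄ ∧ (-i Q₂† dz))`. -/
def ip01 (h Q₁ Q₂ : Mat n) : ℂ :=
  -Matrix.trace (Q₁ * (-Complex.I • adj h Q₂))

/-- The coefficient of `dz ∧ dz̄` in `⟨P₁ dz, P₂ dz⟩_h = tr (P₁ dz ∧ (i P₂† dz̄))`. -/
def ip10 (h P₁ P₂ : Mat n) : ℂ :=
  Matrix.trace (P₁ * (Complex.I • adj h P₂))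

/-- `S` is the positive `h₀`-hermitian square root of the endomorphism `H` with
`h(v, w) = h₀(H v, w)`, that is of `H = h₀⁻¹ h`. -/
def IsPosSqrt (h₀ h S : Mat n) : Prop :=
  (h₀ * S).PosDef ∧ S * S = h₀⁻¹ * h

open scoped MatrixOrder in
theorem exists_posDef_sqrt {h : Mat n} (H : h.PosDef) : ∃ R : Mat n, R.PosDef ∧ R * R = h := by
  refine ⟨CFC.sqrt h, ?_, CFC.sqrt_mul_sqrt_self h H.posSemidef.nonneg⟩
  have := H.isStrictlyPositive
  exact Matrix.isStrictlyPositive_iff_posDef.1 (IsStrictlyPositive.sqrt h this)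

theorem exists_isPosSqrt {h₀ h : Mat n} (H₀ : h₀.PosDef) (H : h.PosDef) :
    ∃ S, IsPosSqrt h₀ h S := by
  obtain ⟨R, hR, rfl⟩ := exists_posDef_sqrt H₀
  have hu : IsUnit R.det := (Matrix.isUnit_iff_isUnit_det R).1 hR.isUnit
  have hRi : R⁻¹ * R = 1 := Matrix.nonsing_inv_mul R hu
  have hRi' : R * R⁻¹ = 1 := Matrix.mul_nonsing_inv R hu
  have hRh : Rᴴ = R := hR.isHermitian
  have hRih : (R⁻¹)ᴴ = R⁻¹ := by rw [Matrix.conjTranspose_nonsing_inv, hRh]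
  have hK : (R⁻¹ * h * R⁻¹).PosDef := by
    have := H.conjTranspose_mul_mul_same (B := R⁻¹)
      (Matrix.mulVec_injective_of_isUnit
        ((Matrix.isUnit_iff_isUnit_det _).2 (Matrix.isUnit_nonsing_inv_det R hu)))
    rwa [hRih] at this
  obtain ⟨K, hKp, hKK⟩ := exists_posDef_sqrt hK
  refine ⟨R⁻¹ * K * R, ?_, ?_⟩
  · have := hKp.conjTranspose_mul_mul_same (B := R)
      (Matrix.mulVec_injective_of_isUnit hR.isUnit)
    rw [hRh] at this
    have e : R * R * (R⁻¹ * K * R) = R * K * R := by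
      calc R * R * (R⁻¹ * K * R) = R * (R * R⁻¹) * K * R := by simp only [Matrix.mul_assoc]
        _ = _ := by rw [hRi', Matrix.mul_one]
    rwa [e]
  · calc R⁻¹ * K * R * (R⁻¹ * K * R) = R⁻¹ * K * (R * R⁻¹) * K * R := by
          simp only [Matrix.mul_assoc]
      _ = R⁻¹ * (K * K) * R := by rw [hRi', Matrix.mul_one]; simp only [Matrix.mul_assoc]
      _ = R⁻¹ * R⁻¹ * h * (R⁻¹ * R) := by rw [hKK]; simp only [Matrix.mul_assoc]
      _ = _ := by rw [hRi, Matrix.mul_one, Matrix.mul_inv_rev]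

open Classical in
/-- The endomorphism `H^{1/2}`, where `h(v, w) = h₀(H v, w)`. -/
def sqrtH (h₀ h : Mat n) : Mat n :=
  if hS : ∃ S, IsPosSqrt h₀ h S then hS.choose else 1

/-! ### Smooth complex vector bundles over a Riemann surface -/

/-- A smooth complex vector bundle of rank `n` over the Riemann surface `C`, given by a smooth
cocycle over a cover by holomorphic coordinate charts: `core` is the cocycle, and the trivializing
set with index `i` is the domain of the coordinate `chart i`. -/
structure SmoothBundle (C : Type*) [TopologicalSpace C] [ChartedSpace ℂ C] (n : ℕ)
    (ι : Type*) where
  /-- The cocycle: `core.coordChange i j x` maps coordinates of a vector in the frame `i` to its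
  coordinates in the frame `j`. -/
  core : VectorBundleCore ℂ C (Fin n → ℂ) ι
  /-- The holomorphic coordinates. -/
  chart : ι → OpenPartialHomeomorph C ℂ
  chart_mem : ∀ i, chart i ∈ IsManifold.maximalAtlas 𝓘(ℂ) ω C
  source_eq : ∀ i, (chart i).source = core.baseSet i
  smooth_coordChange : ∀ i j a b, ContDiffOn ℝ ∞
    (fun z => LinearMap.toMatrix'
      (core.coordChange i j ((chart i).symm z) : (Fin n → ℂ) →ₗ[ℂ] (Fin n → ℂ)) a b)
    ((chart i).target ∩ (chart i).symm ⁻¹' (chart j).source)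

variable {C : Type*} [TopologicalSpace C] [ChartedSpace ℂ C] {ι : Type*}

namespace SmoothBundle

/-- The transition matrix from the frame `i` to the frame `j` at `x`. -/
def trans (B : SmoothBundle C n ι) (i j : ι) (x : C) : Mat n :=
  LinearMap.toMatrix' (B.core.coordChange i j x : (Fin n → ℂ) →ₗ[ℂ] (Fin n → ℂ))

/-- The derivative `dz_j / dz_i` of the coordinate change at `x`. -/
def jac (B : SmoothBundle C n ι) (i j : ι) (x : C) : ℂ :=
  deriv (fun z => B.chart j ((B.chart i).symm z)) (B.chart i x)

end SmoothBundle

/-- Smoothness of a family of local matrix functions, the one with index `i` being a function of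
the coordinate `z_i`. -/
def SmoothFamily (B : SmoothBundle C n ι) (X : ι → ℂ → Mat n) : Prop :=
  ∀ i a b, ContDiffOn ℝ ∞ (fun z => X i z a b) (B.chart i).target

/-- A smooth section of `End E`, by its matrices in the frames `i`. -/
structure EndSection (B : SmoothBundle C n ι) where
  coeff : ι → ℂ → Mat n
  smooth : SmoothFamily B coeff
  compat : ∀ i j, ∀ x ∈ (B.chart i).source ∩ (B.chart j).source,
    coeff j (B.chart j x) * B.trans i j x = B.trans i j x * coeff i (B.chart i x)

/-- A smooth `(1,0)`-form with values in `End E`, equal to `coeff i dz_i` in the frame `i`. -/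
structure Form10 (B : SmoothBundle C n ι) where
  coeff : ι → ℂ → Mat n
  smooth : SmoothFamily B coeff
  compat : ∀ i j, ∀ x ∈ (B.chart i).source ∩ (B.chart j).source,
    B.jac i j x • coeff j (B.chart j x) * B.trans i j x = B.trans i j x * coeff i (B.chart i x)

/-- A smooth `(0,1)`-form with values in `End E`, equal to `coeff i dz̄_i` in the frame `i`. -/
structure Form01 (B : SmoothBundle C n ι) where
  coeff : ι → ℂ → Mat n
  smooth : SmoothFamily B coeff
  compat : ∀ i j, ∀ x ∈ (B.chart i).source ∩ (B.chart j).source,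
    star (B.jac i j x) • coeff j (B.chart j x) * B.trans i j x =
      B.trans i j x * coeff i (B.chart i x)

/-- A smooth hermitian metric on `E`, equal to `h(v, w) = wᴴ (coeff i) v` in the frame `i`. -/
structure HermMetric (B : SmoothBundle C n ι) where
  coeff : ι → ℂ → Mat n
  smooth : SmoothFamily B coeff
  posDef : ∀ i, ∀ z ∈ (B.chart i).target, (coeff i z).PosDef
  compat : ∀ i j, ∀ x ∈ (B.chart i).source ∩ (B.chart j).source,
    (B.trans i j x)ᴴ * coeff j (B.chart j x) * B.trans i j x = coeff i (B.chart i x)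

/-- A holomorphic structure `∂̄_E` on `E`, equal to `∂̄ + coeff i dz̄_i` in the frame `i`. The
compatibility says that `∂̄_E s` does not depend on the frame. -/
structure HolStructure (B : SmoothBundle C n ι) where
  coeff : ι → ℂ → Mat n
  smooth : SmoothFamily B coeff
  compat : ∀ i j, ∀ x ∈ (B.chart i).source ∩ (B.chart j).source,
    matDzbar (fun z => B.trans i j ((B.chart i).symm z)) (B.chart i x) +
      star (B.jac i j x) • coeff j (B.chart j x) * B.trans i j x =
        B.trans i j x * coeff i (B.chart i x)

/-- The matrices of a family are traceless. -/
def Traceless (B : SmoothBundle C n ι) (X : ι → ℂ → Mat n) : Prop :=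
  ∀ i, ∀ z ∈ (B.chart i).target, Matrix.trace (X i z) = 0

/-! ### Higgs bundles and their deformations -/

/-- `(∂̄_E, φ)` is an `SL(n, ℂ)`-Higgs bundle: `φ` is traceless and `∂̄_E φ = 0`. -/
structure IsHiggsBundle {B : SmoothBundle C n ι} (D : HolStructure B) (φ : Form10 B) : Prop where
  traceless : Traceless B φ.coeff
  holomorphic : ∀ i, ∀ z ∈ (B.chart i).target, dbarForm10 (D.coeff i) (φ.coeff i) z = 0

/-- `h` is a harmonic metric: it solves Hitchin's equations `F_{D(∂̄_E, h)} + [φ, φ^{†_h}] = 0`. -/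
def IsHarmonicMetric {B : SmoothBundle C n ι} (D : HolStructure B) (φ : Form10 B)
    (h : HermMetric B) : Prop :=
  ∀ i, ∀ z ∈ (B.chart i).target,
    chernCurvature (D.coeff i) (h.coeff i) z +
      bracket1001 (φ.coeff i z) (adj (h.coeff i z) (φ.coeff i z)) = 0

/-- `(η̇, φ̇)` is an infinitesimal deformation of the `SL(n, ℂ)`-Higgs bundle `(∂̄_E, φ)`: both are
traceless and `∂̄_E φ̇ + [η̇, φ] = 0`. -/
structure IsHiggsDeformation {B : SmoothBundle C n ι} (D : HolStructure B) (φ : Form10 B)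
    (η' : Form01 B) (φ' : Form10 B) : Prop where
  traceless_eta : Traceless B η'.coeff
  traceless_phi : Traceless B φ'.coeff
  linearized : ∀ i, ∀ z ∈ (B.chart i).target,
    dbarForm10 (D.coeff i) (φ'.coeff i) z + bracket0110 (η'.coeff i z) (φ.coeff i z) = 0

/-- The `(0,1)`-form `η̇ - ∂̄_E ν̇`. -/
def etaMinus {B : SmoothBundle C n ι} (D : HolStructure B) (η' : Form01 B) (ν' : EndSection B) :
    ι → ℂ → Mat n :=
  fun i z => η'.coeff i z - dbarEnd (D.coeff i) (ν'.coeff i) z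

/-- The `(1,0)`-form `φ̇ + [ν̇, φ]`. -/
def phiPlus {B : SmoothBundle C n ι} (φ φ' : Form10 B) (ν' : EndSection B) : ι → ℂ → Mat n :=
  fun i z => φ'.coeff i z + comm (ν'.coeff i z) (φ.coeff i z)

/-- The equation `∂_E^h ∂̄_E ν̇ - ∂_E^h η̇ - [φ^{†_h}, φ̇ + [ν̇, φ]] = 0`. -/
def SolvesGaugeEquation {B : SmoothBundle C n ι} (D : HolStructure B) (φ : Form10 B)
    (h : HermMetric B) (η' : Form01 B) (φ' : Form10 B) (ν' : EndSection B) : Prop :=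
  ∀ i, ∀ z ∈ (B.chart i).target,
    delForm01 (D.coeff i) (h.coeff i) (dbarEnd (D.coeff i) (ν'.coeff i)) z
      - delForm01 (D.coeff i) (h.coeff i) (η'.coeff i) z
      - bracket0110 (adj (h.coeff i z) (φ.coeff i z)) (phiPlus φ φ' ν' i z) = 0

/-! ### Integration of 2-forms -/

theorem isManifold_real [IsManifold 𝓘(ℂ) ω C] : IsManifold 𝓘(ℝ, ℂ) ∞ C := by
  refine isManifold_of_contDiffOn _ _ _ fun e e' he he' => ?_
  have h1 : e.symm ≫ₕ e' ∈ contDiffGroupoid ω 𝓘(ℂ) := HasGroupoid.compatible he he'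
  rw [contDiffGroupoid, mem_groupoid_of_pregroupoid] at h1
  have h3 : ContDiffOn ℂ ω (e.symm ≫ₕ e') (e.symm ≫ₕ e').source := by
    simpa [contDiffPregroupoid] using h1.1
  have h4 := (h3.restrict_scalars ℝ).of_le (m := ∞) le_top
  simpa using h4

theorem exists_partition [T2Space C] [CompactSpace C] [IsManifold 𝓘(ℂ) ω C]
    (B : SmoothBundle C n ι) :
    ∃ χ : SmoothPartitionOfUnity ι 𝓘(ℝ, ℂ) C Set.univ,
      χ.IsSubordinate fun i => (B.chart i).source := by
  have := isManifold_real (C := C)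
  refine SmoothPartitionOfUnity.exists_isSubordinate 𝓘(ℝ, ℂ) isClosed_univ _
    (fun i => (B.chart i).open_source) fun x _ => Set.mem_iUnion.2 ⟨B.core.indexAt x, ?_⟩
  rw [B.source_eq]
  exact B.core.mem_baseSet_at x

/-- The integral over `C` of the 2-form equal to `w i dz_i ∧ dz̄_i` in the coordinate `z_i`, by a
smooth partition of unity subordinate to the charts; `dz ∧ dz̄ = -2i dx ∧ dy`. -/
def integralForm [T2Space C] [CompactSpace C] [IsManifold 𝓘(ℂ) ω C]
    (B : SmoothBundle C n ι) (w : ι → ℂ → ℂ) : ℂ :=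
  ∑ᶠ i, ∫ z in (B.chart i).target,
    (((exists_partition B).choose i ((B.chart i).symm z) : ℝ) : ℂ) * (-2 * Complex.I * w i z)

/-! ### The unitary formulation and Hitchin's metric -/

/-- A pair consisting of an `End E`-valued `(0,1)`-form and an `End E`-valued `(1,0)`-form, by their
coefficients. -/
abbrev FormPair (ι : Type*) (n : ℕ) : Type _ := (ι → ℂ → Mat n) × (ι → ℂ → Mat n)

/-- The endomorphism field `H^{1/2}` with `h(v, w) = h₀(H v, w)`. -/
def rootH {B : SmoothBundle C n ι} (h₀ h : HermMetric B) : ι → ℂ → Mat n :=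
  fun i z => sqrtH (h₀.coeff i z) (h.coeff i z)

/-- The operator `∂̄_A = H^{1/2} ∘ ∂̄_E ∘ H^{-1/2} = ∂̄ + (unitaryDbar i) dz̄_i` of the
`h₀`-unitary connection `d_A` associated with `(∂̄_E, φ, h)`. -/
def unitaryDbar {B : SmoothBundle C n ι} (D : HolStructure B) (h₀ h : HermMetric B) :
    ι → ℂ → Mat n :=
  fun i z => rootH h₀ h i z * D.coeff i z * (rootH h₀ h i z)⁻¹ +
    rootH h₀ h i z * matDzbar (fun w => (rootH h₀ h i w)⁻¹) z

/-- The Higgs field `Φ = H^{1/2} φ H^{-1/2}` of the unitary formulation. -/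
def unitaryHiggs {B : SmoothBundle C n ι} (φ : Form10 B) (h₀ h : HermMetric B) :
    ι → ℂ → Mat n :=
  fun i z => rootH h₀ h i z * φ.coeff i z * (rootH h₀ h i z)⁻¹

/-- The unitary deformation `(Ȧ^{0,1}, Φ̇)` associated with `(η̇, φ̇, ν̇)`:
`Ȧ^{0,1} = H^{1/2} (η̇ - ∂̄_E ν̇) H^{-1/2}` and `Φ̇ = H^{1/2} (φ̇ + [ν̇, φ]) H^{-1/2}`. -/
def unitaryDeformation {B : SmoothBundle C n ι} (D : HolStructure B) (φ : Form10 B)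
    (h₀ h : HermMetric B) (η' : Form01 B) (φ' : Form10 B) (ν' : EndSection B) : FormPair ι n :=
  (fun i z => rootH h₀ h i z * etaMinus D η' ν' i z * (rootH h₀ h i z)⁻¹,
   fun i z => rootH h₀ h i z * phiPlus φ φ' ν' i z * (rootH h₀ h i z)⁻¹)

/-- `γ` is a section of `su(E)`, for the hermitian metric `h₀`. -/
def IsSU {B : SmoothBundle C n ι} (h₀ : HermMetric B) (γ : EndSection B) : Prop :=
  Traceless B γ.coeff ∧
    ∀ i, ∀ z ∈ (B.chart i).target, adj (h₀.coeff i z) (γ.coeff i z) = -γ.coeff i z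

/-- The infinitesimal action `ρ(γ) = (-∂̄_A γ, [γ, Φ])` of gauge transformations at the pair
`(∂̄_A, Φ)`, where `∂̄_A = ∂̄ + (αA i) dz̄_i`. -/
def infAction {B : SmoothBundle C n ι} (αA Φ : ι → ℂ → Mat n) (γ : EndSection B) :
    FormPair ι n :=
  (fun i z => -dbarEnd (αA i) (γ.coeff i) z, fun i z => comm (γ.coeff i z) (Φ i z))

section Metric

variable [T2Space C] [CompactSpace C] [IsManifold 𝓘(ℂ) ω C]

/-- `∫_C ⟨Q₁, Q₂⟩_h + ⟨P₁, P₂⟩_h` for `(0,1)`-forms `Q₁, Q₂` and `(1,0)`-forms `P₁, P₂`. -/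
def integralPairing {B : SmoothBundle C n ι} (h : HermMetric B) (X Y : FormPair ι n) : ℂ :=
  integralForm B fun i z =>
    ip01 (h.coeff i z) (X.1 i z) (Y.1 i z) + ip10 (h.coeff i z) (X.2 i z) (Y.2 i z)

/-- The `L²`-metric `g` on `Ω^{0,1}(sl E) ⊕ Ω^{1,0}(sl E)` of the unitary formulation. -/
def gMetric {B : SmoothBundle C n ι} (h₀ : HermMetric B) (X Y : FormPair ι n) : ℝ :=
  2 * (integralPairing h₀ X Y).re

/-- `X` is `g`-perpendicular to the image of the infinitesimal action `ρ` of the `h₀`-unitary gauge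
transformations at the pair `(∂̄_A, Φ)`. -/
def PerpToGauge {B : SmoothBundle C n ι} (h₀ : HermMetric B) (αA Φ : ι → ℂ → Mat n)
    (X : FormPair ι n) : Prop :=
  ∀ δ : EndSection B, IsSU h₀ δ → gMetric h₀ X (infAction αA Φ δ) = 0

open Classical in
/-- Hitchin's hyperkähler metric: `‖X‖²_{g_{L²}} = ‖X^⊥‖²_g`, where `X = ρ(γ) + X^⊥` with `γ` in
`Ω⁰(su E)` and `X^⊥` perpendicular to the image of `ρ`. (The value does not depend on `γ`; it is
set to `0` if there is no such decomposition.) -/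
def gL2NormSq {B : SmoothBundle C n ι} (h₀ : HermMetric B) (αA Φ : ι → ℂ → Mat n)
    (X : FormPair ι n) : ℝ :=
  if hγ : ∃ γ : EndSection B, IsSU h₀ γ ∧ PerpToGauge h₀ αA Φ (X - infAction αA Φ γ) then
    gMetric h₀ (X - infAction αA Φ hγ.choose) (X - infAction αA Φ hγ.choose)
  else 0

end Metric

end HitchinMetric

end

namespace HitchinMetric

variable {n : ℕ}

/-! ### Calculus of matrix functions -/

/-- The entries of `A` are smooth on `U`. -/
def SmoothMatOn (A : ℂ → Mat n) (U : Set ℂ) : Prop :=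
  ∀ a b, ContDiffOn ℝ ∞ (fun z => A z a b) U

/-- The entries of `A` are differentiable at `z`. -/
def MatDiffAt (A : ℂ → Mat n) (z : ℂ) : Prop :=
  ∀ a b, DifferentiableAt ℝ (fun w => A w a b) z

section Wirtinger

variable {f g : ℂ → ℂ} {z : ℂ}

theorem wirtDz_add (hf : DifferentiableAt ℝ f z) (hg : DifferentiableAt ℝ g z) :
    wirtDz (fun w => f w + g w) z = wirtDz f z + wirtDz g z := by
  simp only [wirtDz, fderiv_fun_add hf hg, add_apply]; ring

theorem wirtDz_mul (hf : DifferentiableAt ℝ f z) (hg : DifferentiableAt ℝ g z) :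
    wirtDz (fun w => f w * g w) z = wirtDz f z * g z + f z * wirtDz g z := by
  simp only [wirtDz, fderiv_fun_mul hf hg, add_apply,
    smul_apply, smul_eq_mul]
  ring

theorem wirtDzbar_mul (hf : DifferentiableAt ℝ f z) (hg : DifferentiableAt ℝ g z) :
    wirtDzbar (fun w => f w * g w) z = wirtDzbar f z * g z + f z * wirtDzbar g z := by
  simp only [wirtDzbar, fderiv_fun_mul hf hg, add_apply,
    smul_apply, smul_eq_mul]
  ring

theorem wirtDz_sum {κ : Type*} {s : Finset κ} {F : κ → ℂ → ℂ}
    (hF : ∀ k ∈ s, DifferentiableAt ℝ (F k) z) :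
    wirtDz (fun w => ∑ k ∈ s, F k w) z = ∑ k ∈ s, wirtDz (F k) z := by
  simp only [wirtDz, fderiv_fun_sum hF, FunLike.coe_sum, Finset.sum_apply,
    ← Finset.sum_div, Finset.mul_sum, Finset.sum_sub_distrib]

theorem wirtDzbar_sum {κ : Type*} {s : Finset κ} {F : κ → ℂ → ℂ}
    (hF : ∀ k ∈ s, DifferentiableAt ℝ (F k) z) :
    wirtDzbar (fun w => ∑ k ∈ s, F k w) z = ∑ k ∈ s, wirtDzbar (F k) z := by
  simp only [wirtDzbar, fderiv_fun_sum hF, FunLike.coe_sum, Finset.sum_apply,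
    ← Finset.sum_div, Finset.mul_sum, Finset.sum_add_distrib]

theorem wirtDz_star (hf : DifferentiableAt ℝ f z) :
    wirtDz (fun w => star (f w)) z = star (wirtDzbar f z) := by
  have h : HasFDerivAt (fun w => star (f w))
      ((Complex.conjCLE : ℂ →L[ℝ] ℂ).comp (fderiv ℝ f z)) z :=
    (Complex.conjCLE : ℂ →L[ℝ] ℂ).hasFDerivAt.comp z hf.hasFDerivAt
  simp only [wirtDz, wirtDzbar, h.fderiv]
  simp [sub_eq_add_neg]

theorem wirtDz_congr (h : f =ᶠ[nhds z] g) : wirtDz f z = wirtDz g z := by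
  simp only [wirtDz, h.fderiv_eq]

theorem wirtDzbar_congr (h : f =ᶠ[nhds z] g) : wirtDzbar f z = wirtDzbar g z := by
  simp only [wirtDzbar, h.fderiv_eq]

theorem wirtDz_const (c : ℂ) : wirtDz (fun _ => c) z = 0 := by simp [wirtDz]

theorem wirtDzbar_const (c : ℂ) : wirtDzbar (fun _ => c) z = 0 := by simp [wirtDzbar]

theorem fderiv_comp_complex {ψ : ℂ → ℂ} {d : ℂ} (hψ : HasDerivAt ψ d z)
    (hf : DifferentiableAt ℝ f (ψ z)) (v : ℂ) :
    fderiv ℝ (fun w => f (ψ w)) z v = fderiv ℝ f (ψ z) (d * v) := by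
  have h := hf.hasFDerivAt.comp z (hψ.hasFDerivAt.restrictScalars ℝ)
  have e : fderiv ℝ (fun w => f (ψ w)) z = _ := h.fderiv
  rw [e]
  simp [mul_comm]

theorem fderiv_apply_eq (L : ℂ →L[ℝ] ℂ) (d : ℂ) : L d = d.re * L 1 + d.im * L Complex.I := by
  have : d = d.re • (1 : ℂ) + d.im • Complex.I := by simp [Complex.re_add_im]
  conv_lhs => rw [this, map_add, map_smul, map_smul]
  simp

theorem wirtDz_comp {ψ : ℂ → ℂ} {d : ℂ} (hψ : HasDerivAt ψ d z)
    (hf : DifferentiableAt ℝ f (ψ z)) :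
    wirtDz (fun w => f (ψ w)) z = d * wirtDz f (ψ z) := by
  simp only [wirtDz, fderiv_comp_complex hψ hf]
  rw [fderiv_apply_eq _ (d * 1), fderiv_apply_eq _ (d * Complex.I)]
  simp
  linear_combination ((d.im : ℂ) * fderiv ℝ f (ψ z) Complex.I / 2) * Complex.I_sq +
    (fderiv ℝ f (ψ z) 1 - Complex.I * fderiv ℝ f (ψ z) Complex.I) / 2 * Complex.re_add_im d

theorem wirtDzbar_comp {ψ : ℂ → ℂ} {d : ℂ} (hψ : HasDerivAt ψ d z)
    (hf : DifferentiableAt ℝ f (ψ z)) :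
    wirtDzbar (fun w => f (ψ w)) z = star d * wirtDzbar f (ψ z) := by
  simp only [wirtDzbar, fderiv_comp_complex hψ hf]
  rw [fderiv_apply_eq _ (d * 1), fderiv_apply_eq _ (d * Complex.I)]
  have : star d = d.re - d.im * Complex.I := by
    apply Complex.ext <;> simp
  rw [this]
  simp
  linear_combination ((d.im : ℂ) * fderiv ℝ f (ψ z) Complex.I / 2) * Complex.I_sq

theorem contDiffOn_wirtDz {U : Set ℂ} (hU : IsOpen U) (hf : ContDiffOn ℝ ∞ f U) :
    ContDiffOn ℝ ∞ (wirtDz f) U := by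
  have h := hf.fderiv_of_isOpen (m := ∞) hU (by simp)
  unfold wirtDz
  exact ((h.clm_apply contDiffOn_const).sub
    (contDiffOn_const.mul (h.clm_apply contDiffOn_const))).div_const _

theorem contDiffOn_wirtDzbar {U : Set ℂ} (hU : IsOpen U) (hf : ContDiffOn ℝ ∞ f U) :
    ContDiffOn ℝ ∞ (wirtDzbar f) U := by
  have h := hf.fderiv_of_isOpen (m := ∞) hU (by simp)
  unfold wirtDzbar
  exact ((h.clm_apply contDiffOn_const).add
    (contDiffOn_const.mul (h.clm_apply contDiffOn_const))).div_const _

end Wirtinger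

section Smooth

variable {A A' : ℂ → Mat n} {U : Set ℂ}

theorem SmoothMatOn.matDiffAt (hA : SmoothMatOn A U) (hU : IsOpen U) {z : ℂ} (hz : z ∈ U) :
    MatDiffAt A z :=
  fun a b => ((hA a b).contDiffAt (hU.mem_nhds hz)).differentiableAt (by simp)

theorem SmoothMatOn.congr (hA : SmoothMatOn A U) (h : ∀ z ∈ U, A' z = A z) :
    SmoothMatOn A' U :=
  fun a b => (hA a b).congr fun z hz => by rw [h z hz]

theorem SmoothMatOn.add (hA : SmoothMatOn A U) (hA' : SmoothMatOn A' U) :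
    SmoothMatOn (fun z => A z + A' z) U :=
  fun a b => (hA a b).add (hA' a b)

theorem SmoothMatOn.sub (hA : SmoothMatOn A U) (hA' : SmoothMatOn A' U) :
    SmoothMatOn (fun z => A z - A' z) U :=
  fun a b => (hA a b).sub (hA' a b)

theorem SmoothMatOn.mul (hA : SmoothMatOn A U) (hA' : SmoothMatOn A' U) :
    SmoothMatOn (fun z => A z * A' z) U := by
  intro a b
  simp only [Matrix.mul_apply]
  exact ContDiffOn.sum fun c _ => (hA a c).mul (hA' c b)

theorem SmoothMatOn.comm (hA : SmoothMatOn A U) (hA' : SmoothMatOn A' U) :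
    SmoothMatOn (fun z => HitchinMetric.comm (A z) (A' z)) U :=
  (hA.mul hA').sub (hA'.mul hA)

theorem SmoothMatOn.conjTranspose (hA : SmoothMatOn A U) : SmoothMatOn (fun z => (A z)ᴴ) U :=
  fun a b => (Complex.conjCLE : ℂ →L[ℝ] ℂ).contDiff.comp_contDiffOn (hA b a)

theorem SmoothMatOn.trace (hA : SmoothMatOn A U) :
    ContDiffOn ℝ ∞ (fun z => (A z).trace) U := by
  simp only [Matrix.trace, Matrix.diag_apply]
  exact ContDiffOn.sum fun c _ => hA c c

theorem SmoothMatOn.det (hA : SmoothMatOn A U) : ContDiffOn ℝ ∞ (fun z => (A z).det) U := by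
  simp only [Matrix.det_apply']
  exact ContDiffOn.sum fun c _ => contDiffOn_const.mul (contDiffOn_prod fun i _ => hA _ _)

theorem SmoothMatOn.inv (hA : SmoothMatOn A U) (h : ∀ z ∈ U, (A z).det ≠ 0) :
    SmoothMatOn (fun z => (A z)⁻¹) U := by
  intro a b
  simp only [Matrix.inv_def, Ring.inverse_eq_inv', Matrix.smul_apply, smul_eq_mul]
  refine (hA.det.inv h).mul ?_
  simp only [Matrix.adjugate_apply]
  refine SmoothMatOn.det fun c d => ?_
  by_cases hc : c = b
  · subst hc
    simpa using contDiffOn_const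
  · simpa [Matrix.updateRow_ne hc] using hA c d

theorem SmoothMatOn.matDzbar (hA : SmoothMatOn A U) (hU : IsOpen U) :
    SmoothMatOn (matDzbar A) U :=
  fun a b => contDiffOn_wirtDzbar hU (hA a b)

theorem SmoothMatOn.adj {h : ℂ → Mat n} (hh : SmoothMatOn h U) (hpos : ∀ z ∈ U, (h z).PosDef)
    (hA : SmoothMatOn A U) : SmoothMatOn (fun z => adj (h z) (A z)) U :=
  ((hh.inv fun z hz => (hpos z hz).det_pos.ne').mul hA.conjTranspose).mul hh

end Smooth

section Leibniz

variable {A A' : ℂ → Mat n} {z : ℂ}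

theorem MatDiffAt.mul (hA : MatDiffAt A z) (hA' : MatDiffAt A' z) :
    MatDiffAt (fun w => A w * A' w) z := by
  intro a b
  simp only [Matrix.mul_apply]
  exact DifferentiableAt.fun_sum fun c _ => (hA a c).mul (hA' c b)

theorem MatDiffAt.conjTranspose (hA : MatDiffAt A z) : MatDiffAt (fun w => (A w)ᴴ) z :=
  fun a b => (Complex.conjCLE : ℂ →L[ℝ] ℂ).differentiableAt.comp z (hA b a)

theorem matDz_mul (hA : MatDiffAt A z) (hA' : MatDiffAt A' z) :
    matDz (fun w => A w * A' w) z = matDz A z * A' z + A z * matDz A' z := by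
  ext a b
  simp only [matDz, Matrix.of_apply, Matrix.add_apply, Matrix.mul_apply]
  rw [wirtDz_sum (F := fun c w => A w a c * A' w c b) fun c _ => (hA a c).mul (hA' c b),
    ← Finset.sum_add_distrib]
  exact Finset.sum_congr rfl fun c _ => wirtDz_mul (hA a c) (hA' c b)

theorem matDzbar_mul (hA : MatDiffAt A z) (hA' : MatDiffAt A' z) :
    matDzbar (fun w => A w * A' w) z = matDzbar A z * A' z + A z * matDzbar A' z := by
  ext a b
  simp only [matDzbar, Matrix.of_apply, Matrix.add_apply, Matrix.mul_apply]
  rw [wirtDzbar_sum (F := fun c w => A w a c * A' w c b) fun c _ => (hA a c).mul (hA' c b),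
    ← Finset.sum_add_distrib]
  exact Finset.sum_congr rfl fun c _ => wirtDzbar_mul (hA a c) (hA' c b)

theorem matDz_conjTranspose (hA : MatDiffAt A z) :
    matDz (fun w => (A w)ᴴ) z = (matDzbar A z)ᴴ := by
  ext a b
  exact wirtDz_star (hA b a)

theorem matDz_congr (h : A =ᶠ[nhds z] A') : matDz A z = matDz A' z := by
  ext a b
  exact wirtDz_congr (h.mono fun w hw => by simp only [hw])

theorem matDzbar_congr (h : A =ᶠ[nhds z] A') : matDzbar A z = matDzbar A' z := by
  ext a b
  exact wirtDzbar_congr (h.mono fun w hw => by simp only [hw])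

theorem matDzbar_const (M : Mat n) : matDzbar (fun _ => M) z = 0 := by
  ext a b
  exact wirtDzbar_const _

theorem matDzbar_comp {ψ : ℂ → ℂ} {d : ℂ} (hψ : HasDerivAt ψ d z) (hA : MatDiffAt A (ψ z)) :
    matDzbar (fun w => A (ψ w)) z = star d • matDzbar A (ψ z) := by
  ext a b
  exact wirtDzbar_comp hψ (hA a b)

theorem wirtDz_trace (hA : MatDiffAt A z) :
    wirtDz (fun w => (A w).trace) z = (matDz A z).trace := by
  simp only [Matrix.trace, Matrix.diag_apply]
  exact wirtDz_sum fun c _ => hA c c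

end Leibniz

end HitchinMetric

namespace HitchinMetric

variable {n : ℕ}

/-! ### The positive square root -/

/-- The Sylvester operator `X ↦ K X + X K` of a positive definite matrix is injective. -/
theorem eq_zero_of_sylvester {K X : Mat n} (hK : K.PosDef) (h : K * X + X * K = 0) : X = 0 := by
  have h1 : (Xᴴ * K * X).PosSemidef := hK.posSemidef.conjTranspose_mul_mul_same X
  have h2 : (X * K * Xᴴ).PosSemidef := hK.posSemidef.mul_mul_conjTranspose_same X
  have h3 : (Xᴴ * K * X).trace + (X * K * Xᴴ).trace = 0 := by
    rw [Matrix.trace_mul_comm (X * K), ← Matrix.trace_add, Matrix.mul_assoc, ← Matrix.mul_add, h]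
    simp
  have h4 : Xᴴ * K * X = 0 := h1.trace_eq_zero_iff.1
    (le_antisymm (by rw [eq_neg_of_add_eq_zero_left h3]; exact neg_nonpos.2 h2.trace_nonneg)
      h1.trace_nonneg)
  obtain ⟨R, hR, rfl⟩ := exists_posDef_sqrt hK
  have h5 : (R * X)ᴴ * (R * X) = 0 := by
    rw [Matrix.conjTranspose_mul, hR.isHermitian.eq, ← h4]
    simp only [Matrix.mul_assoc]
  have h6 : R * X = 0 := Matrix.conjTranspose_mul_self_eq_zero.1 h5
  have hu : IsUnit R.det := (Matrix.isUnit_iff_isUnit_det R).1 hR.isUnit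
  rw [← Matrix.nonsing_inv_mul_cancel_left R X hu, h6, Matrix.mul_zero]

section L2Norm

open scoped Matrix.Norms.L2Operator MatrixOrder

theorem SmoothMatOn.contDiffOn {A : ℂ → Mat n} {U : Set ℂ} (hA : SmoothMatOn A U) :
    ContDiffOn ℝ ∞ A U := by
  have : A = fun z => ∑ a, ∑ b, A z a b • Matrix.single a b (1 : ℂ) := by
    funext z
    conv_lhs => rw [Matrix.matrix_eq_sum_single (A z)]
    simp [Matrix.smul_single]
  rw [this]
  exact ContDiffOn.sum fun a _ => ContDiffOn.sum fun b _ => (hA a b).smul contDiffOn_const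

theorem smoothMatOn_of_contDiffOn {A : ℂ → Mat n} {U : Set ℂ} (hA : ContDiffOn ℝ ∞ A U) :
    SmoothMatOn A U := fun a b =>
  (LinearMap.toContinuousLinearMap (Matrix.entryLinearMap ℝ ℂ a b :
    Mat n →ₗ[ℝ] ℂ)).contDiff.comp_contDiffOn hA

theorem continuousOn_sqrt : ContinuousOn (CFC.sqrt : Mat n → Mat n) {h | 0 ≤ h} := by
  have h := ContinuousOn.cfc_nnreal_of_mem_nhdsSet (A := Mat n) (a := id) (t := {h | 0 ≤ h})
    (s := Set.univ) NNReal.sqrt Filter.univ_mem continuousOn_id (fun x hx => hx)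
    NNReal.continuous_sqrt.continuousOn
  exact h.congr fun x hx => CFC.sqrt_eq_cfc

theorem contDiffAt_sqrt_comp {h : ℂ → Mat n} {U : Set ℂ} (hU : IsOpen U)
    (hh : ContDiffOn ℝ ∞ h U) (hpos : ∀ z ∈ U, (h z).PosDef) {z : ℂ} (hz : z ∈ U) :
    ContDiffAt ℝ ∞ (fun w => CFC.sqrt (h w)) z := by
  set K : Mat n := CFC.sqrt (h z) with hKdef
  have hK : K.PosDef := Matrix.isStrictlyPositive_iff_posDef.1
    (IsStrictlyPositive.sqrt (h z) (hpos z hz).isStrictlyPositive)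
  have hKK : ∀ w ∈ U, CFC.sqrt (h w) * CFC.sqrt (h w) = h w := fun w hw =>
    CFC.sqrt_mul_sqrt_self _ (hpos w hw).posSemidef.nonneg
  let L : Mat n →ₗ[ℝ] Mat n := LinearMap.mulLeft ℝ K + LinearMap.mulRight ℝ K
  have hL : Function.Injective L := by
    rw [← LinearMap.ker_eq_bot, LinearMap.ker_eq_bot']
    intro X hX
    exact eq_zero_of_sylvester hK hX
  let e : Mat n ≃L[ℝ] Mat n := (LinearEquiv.ofInjectiveEndo L hL).toContinuousLinearEquiv
  have hF : ContDiffAt ℝ ∞ (fun X : Mat n => X * X) K := contDiffAt_id.mul contDiffAt_id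
  have hF' : HasFDerivAt (fun X : Mat n => X * X) (e : Mat n →L[ℝ] Mat n) K := by
    have h1 := (hasFDerivAt_id (𝕜 := ℝ) K).mul' (hasFDerivAt_id (𝕜 := ℝ) K)
    refine h1.congr_fderiv ?_
    ext1 X
    simp [e, L]
  have hs := hF.to_localInverse hF' (by simp)
  have hev : ∀ᶠ X in nhds K, hF.localInverse hF' (by simp) (X * X) = X :=
    (hF.hasStrictFDerivAt' hF' (by simp)).eventually_left_inverse
  have hcont : ContinuousAt (fun w => CFC.sqrt (h w)) z :=
    (continuousOn_sqrt.comp hh.continuousOn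
      fun w hw => (hpos w hw).posSemidef.nonneg).continuousAt (hU.mem_nhds hz)
  have hcomp : ContDiffAt ℝ ∞ (fun w => hF.localInverse hF' (by simp) (h w)) z := by
    refine ContDiffAt.comp z ?_ (hh.contDiffAt (hU.mem_nhds hz))
    rw [← hKK z hz]
    exact hs
  refine hcomp.congr_of_eventuallyEq ?_
  filter_upwards [hcont.eventually hev, hU.mem_nhds hz] with w hw hwU
  rw [hKK w hwU] at hw
  exact hw.symm

theorem smoothMatOn_sqrt {h : ℂ → Mat n} {U : Set ℂ} (hU : IsOpen U)
    (hh : SmoothMatOn h U) (hpos : ∀ z ∈ U, (h z).PosDef) :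
    SmoothMatOn (fun z => CFC.sqrt (h z)) U :=
  smoothMatOn_of_contDiffOn fun _ hz =>
    (contDiffAt_sqrt_comp hU hh.contDiffOn hpos hz).contDiffWithinAt

theorem posDef_sqrt {h : Mat n} (H : h.PosDef) : (CFC.sqrt h).PosDef :=
  Matrix.isStrictlyPositive_iff_posDef.1 (IsStrictlyPositive.sqrt h H.isStrictlyPositive)

theorem IsPosSqrt.eq {h₀ h S : Mat n} (H₀ : h₀.PosDef) (hS : IsPosSqrt h₀ h S) :
    S = (CFC.sqrt h₀)⁻¹ * CFC.sqrt ((CFC.sqrt h₀)⁻¹ * h * (CFC.sqrt h₀)⁻¹) * CFC.sqrt h₀ := by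
  set R := CFC.sqrt h₀ with hRdef
  have hR : R.PosDef := posDef_sqrt H₀
  have hRR : R * R = h₀ := CFC.sqrt_mul_sqrt_self h₀ H₀.posSemidef.nonneg
  have hu : IsUnit R.det := (Matrix.isUnit_iff_isUnit_det R).1 hR.isUnit
  have hRh : Rᴴ = R := hR.isHermitian
  have hRih : (R⁻¹)ᴴ = R⁻¹ := by rw [Matrix.conjTranspose_nonsing_inv, hRh]
  have hK : (R * S * R⁻¹).PosSemidef := by
    have h1 := hS.1.posSemidef.conjTranspose_mul_mul_same R⁻¹
    rw [hRih, ← hRR, ← Matrix.mul_assoc, ← Matrix.mul_assoc, Matrix.nonsing_inv_mul _ hu,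
      Matrix.one_mul] at h1
    exact h1
  have hsq : R * S * R⁻¹ * (R * S * R⁻¹) = R⁻¹ * h * R⁻¹ := by
    calc R * S * R⁻¹ * (R * S * R⁻¹) = R * S * (R⁻¹ * R) * S * R⁻¹ := by
          simp only [Matrix.mul_assoc]
      _ = R * (S * S) * R⁻¹ := by
          rw [Matrix.nonsing_inv_mul _ hu, Matrix.mul_one]; simp only [Matrix.mul_assoc]
      _ = (R * R⁻¹) * R⁻¹ * h * R⁻¹ := by
          rw [hS.2, ← hRR, Matrix.mul_inv_rev]; simp only [Matrix.mul_assoc]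
      _ = _ := by rw [Matrix.mul_nonsing_inv _ hu, Matrix.one_mul]
  rw [CFC.sqrt_unique hsq hK.nonneg]
  calc S = (R⁻¹ * R) * S * (R⁻¹ * R) := by
        rw [Matrix.nonsing_inv_mul _ hu, Matrix.one_mul, Matrix.mul_one]
    _ = _ := by simp only [Matrix.mul_assoc]

end L2Norm

theorem IsPosSqrt.unique {h₀ h S T : Mat n} (H₀ : h₀.PosDef) (hS : IsPosSqrt h₀ h S)
    (hT : IsPosSqrt h₀ h T) : S = T :=
  (hS.eq H₀).trans (hT.eq H₀).symm

theorem isPosSqrt_sqrtH {h₀ h : Mat n} (H₀ : h₀.PosDef) (H : h.PosDef) :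
    IsPosSqrt h₀ h (sqrtH h₀ h) := by
  have hS := exists_isPosSqrt H₀ H
  rw [sqrtH, dif_pos hS]
  exact hS.choose_spec

theorem IsPosSqrt.det_ne_zero {h₀ h S : Mat n} (hS : IsPosSqrt h₀ h S) : S.det ≠ 0 := by
  have h1 := hS.1.det_pos.ne'
  rw [Matrix.det_mul] at h1
  exact right_ne_zero_of_mul h1

theorem IsPosSqrt.mul_mul {h₀ h S : Mat n} (H₀ : h₀.PosDef) (hS : IsPosSqrt h₀ h S) :
    h₀ * S * S = h := by
  rw [Matrix.mul_assoc, hS.2, Matrix.mul_nonsing_inv_cancel_left _ _ H₀.det_pos.ne'.isUnit]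

/-- `S` is self-adjoint for `h₀`. -/
theorem IsPosSqrt.conjTranspose_mul {h₀ h S : Mat n} (H₀ : h₀.PosDef) (hS : IsPosSqrt h₀ h S) :
    Sᴴ * h₀ = h₀ * S := by
  have h1 := hS.1.isHermitian.eq
  rwa [Matrix.conjTranspose_mul, H₀.isHermitian.eq] at h1

/-- Conjugation by `H^{1/2}` turns `h`-adjoints into `h₀`-adjoints. -/
theorem IsPosSqrt.adj_conj {h₀ h S : Mat n} (H₀ : h₀.PosDef) (hS : IsPosSqrt h₀ h S)
    (X : Mat n) : adj h₀ (S * X * S⁻¹) = S * adj h X * S⁻¹ := by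
  have hu : IsUnit S.det := hS.det_ne_zero.isUnit
  have e1 := hS.conjTranspose_mul H₀
  have e5 : h = h₀ * S * S := (hS.mul_mul H₀).symm
  rw [adj, adj, Matrix.conjTranspose_mul, Matrix.conjTranspose_mul,
    Matrix.conjTranspose_nonsing_inv, e5, Matrix.mul_inv_rev, Matrix.mul_inv_rev]
  have e6 : h₀⁻¹ * (Sᴴ)⁻¹ = S⁻¹ * h₀⁻¹ := by
    rw [← Matrix.mul_inv_rev, e1, Matrix.mul_inv_rev]
  calc h₀⁻¹ * ((Sᴴ)⁻¹ * (Xᴴ * Sᴴ)) * h₀ = (h₀⁻¹ * (Sᴴ)⁻¹) * Xᴴ * (Sᴴ * h₀) := by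
        simp only [Matrix.mul_assoc]
    _ = S⁻¹ * h₀⁻¹ * Xᴴ * (h₀ * S) := by rw [e6, e1]
    _ = (S * S⁻¹) * S⁻¹ * h₀⁻¹ * Xᴴ * (h₀ * S) * (S * S⁻¹) := by
        rw [Matrix.mul_nonsing_inv _ hu, Matrix.one_mul, Matrix.mul_one]
    _ = _ := by simp only [Matrix.mul_assoc]

end HitchinMetric

namespace HitchinMetric

/-! ### Stokes' theorem -/

section Local

open MeasureTheory

variable {U K : Set ℂ} {u : ℂ → ℂ}

theorem integrableOn_of_eq_zero_off_compact (hU : IsOpen U) (hK : IsCompact K) (hKU : K ⊆ U)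
    (hu : ContinuousOn u U) (h0 : ∀ z ∈ U, z ∉ K → u z = 0) : IntegrableOn u U :=
  ((hu.mono hKU).integrableOn_compact hK).of_forall_sdiff_eq_zero hU.measurableSet
    fun z hz => h0 z hz.1 hz.2

theorem integral_fderiv_apply_eq_zero (hu : ContDiff ℝ 1 u) (hc : HasCompactSupport u) (v : ℂ) :
    Integrable (fun z => fderiv ℝ u z v) ∧ ∫ z, fderiv ℝ u z v = 0 := by
  have h1 : Integrable (fun z => fderiv ℝ u z v) :=
    ((hu.continuous_fderiv (by simp)).clm_apply continuous_const).integrable_of_hasCompactSupport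
      (hc.fderiv_apply (𝕜 := ℝ) v)
  refine ⟨h1, ?_⟩
  have h2 := integral_mul_fderiv_eq_neg_fderiv_mul_of_integrable (μ := volume) (𝕜 := ℂ)
    (f := fun _ => (1 : ℂ)) (g := u) (v := v) (by simp) (by simpa using h1)
    (by simpa using hu.continuous.integrable_of_hasCompactSupport hc)
    (fun _ _ => differentiableAt_const _)
    (fun z _ => (hu.differentiable (by simp)) z)
  simpa using h2

/-- The integral of `∂u/∂z` over an open set vanishes if `u` has compact support there. -/
theorem setIntegral_wirtDz_eq_zero (hU : IsOpen U) (hK : IsCompact K) (hKU : K ⊆ U)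
    (hu : ContDiffOn ℝ ∞ u U) (h0 : ∀ z ∈ U, z ∉ K → u z = 0) :
    ∫ z in U, wirtDz u z = 0 := by
  set v : ℂ → ℂ := U.indicator u with hv
  have hvK : ∀ z, z ∉ K → v z = 0 := fun z hz => by
    by_cases hzU : z ∈ U
    · rw [hv, Set.indicator_of_mem hzU, h0 z hzU hz]
    · rw [hv, Set.indicator_of_notMem hzU]
  have hvu : ∀ z ∈ U, v =ᶠ[nhds z] u := fun z hz => by
    filter_upwards [hU.mem_nhds hz] with w hw
    rw [hv, Set.indicator_of_mem hw]
  have hv0 : ∀ z, z ∉ U → v =ᶠ[nhds z] fun _ => 0 := fun z hz => by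
    filter_upwards [hK.isClosed.isOpen_compl.mem_nhds fun h => hz (hKU h)] with w hw
    exact hvK w hw
  have hcd : ContDiff ℝ 1 v := by
    rw [contDiff_iff_contDiffAt]
    intro z
    by_cases hz : z ∈ U
    · exact ((hu.contDiffAt (hU.mem_nhds hz)).congr_of_eventuallyEq (hvu z hz)).of_le
        (by exact_mod_cast le_top)
    · exact contDiffAt_const.congr_of_eventuallyEq (hv0 z hz)
  have hcs : HasCompactSupport v := HasCompactSupport.intro hK hvK
  have e1 : ∫ z in U, wirtDz u z = ∫ z in U, wirtDz v z :=
    setIntegral_congr_fun hU.measurableSet fun z hz => (wirtDz_congr (hvu z hz)).symm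
  have e2 : ∫ z in U, wirtDz v z = ∫ z, wirtDz v z :=
    setIntegral_eq_integral_of_forall_compl_eq_zero fun z hz => by
      rw [wirtDz_congr (hv0 z hz), wirtDz_const]
  obtain ⟨i1, z1⟩ := integral_fderiv_apply_eq_zero hcd hcs 1
  obtain ⟨i2, z2⟩ := integral_fderiv_apply_eq_zero hcd hcs Complex.I
  rw [e1, e2]
  unfold wirtDz
  rw [integral_div, integral_sub i1 (i2.const_mul _), integral_const_mul, z1, z2]
  simp

end Local

variable {C : Type*} [TopologicalSpace C] [ChartedSpace ℂ C] {n : ℕ} {ι : Type*}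

theorem contDiffOn_transition {e e' : OpenPartialHomeomorph C ℂ} [IsManifold 𝓘(ℂ) ω C]
    (he : e ∈ IsManifold.maximalAtlas 𝓘(ℂ) ω C) (he' : e' ∈ IsManifold.maximalAtlas 𝓘(ℂ) ω C) :
    ContDiffOn ℂ ω (e.symm ≫ₕ e') (e.symm ≫ₕ e').source := by
  have h1 : e.symm ≫ₕ e' ∈ contDiffGroupoid ω 𝓘(ℂ) :=
    StructureGroupoid.compatible_of_mem_maximalAtlas he he'
  rw [contDiffGroupoid, mem_groupoid_of_pregroupoid] at h1
  simpa [contDiffPregroupoid] using h1.1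

theorem mem_maximalAtlas_real {e : OpenPartialHomeomorph C ℂ} [IsManifold 𝓘(ℂ) ω C]
    (he : e ∈ IsManifold.maximalAtlas 𝓘(ℂ) ω C) :
    e ∈ IsManifold.maximalAtlas 𝓘(ℝ, ℂ) ∞ C := by
  have key : ∀ {e e' : OpenPartialHomeomorph C ℂ}, e ∈ IsManifold.maximalAtlas 𝓘(ℂ) ω C →
      e' ∈ IsManifold.maximalAtlas 𝓘(ℂ) ω C →
      e.symm ≫ₕ e' ∈ contDiffGroupoid ∞ 𝓘(ℝ, ℂ) := by
    intro e e' he he'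
    have h1 := ((contDiffOn_transition he he').restrict_scalars ℝ).of_le (m := ∞) le_top
    have h2 := ((contDiffOn_transition he' he).restrict_scalars ℝ).of_le (m := ∞) le_top
    rw [contDiffGroupoid, mem_groupoid_of_pregroupoid]
    constructor
    · simpa [contDiffPregroupoid] using h1
    · simpa [contDiffPregroupoid] using h2
  intro e' he'
  have he'' : e' ∈ IsManifold.maximalAtlas 𝓘(ℂ) ω C := IsManifold.subset_maximalAtlas he'
  exact ⟨key he he'', key he'' he⟩

namespace SmoothBundle

/-- The part of the range of the coordinate `i` over which the coordinate `j` is defined. -/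
def overlap (B : SmoothBundle C n ι) (i j : ι) : Set ℂ :=
  (B.chart i).target ∩ (B.chart i).symm ⁻¹' (B.chart j).source

/-- The coordinate change from the coordinate `i` to the coordinate `j`. -/
noncomputable def change (B : SmoothBundle C n ι) (i j : ι) (z : ℂ) : ℂ := B.chart j ((B.chart i).symm z)

variable (B : SmoothBundle C n ι)

theorem isOpen_overlap (i j : ι) : IsOpen (B.overlap i j) :=
  (B.chart i).isOpen_inter_preimage_symm (B.chart j).open_source

theorem symm_mem {i j : ι} {z : ℂ} (hz : z ∈ B.overlap i j) :
    (B.chart i).symm z ∈ (B.chart i).source ∩ (B.chart j).source :=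
  ⟨(B.chart i).map_target hz.1, hz.2⟩

theorem mem_overlap {i j : ι} {x : C} (hx : x ∈ (B.chart i).source ∩ (B.chart j).source) :
    B.chart i x ∈ B.overlap i j :=
  ⟨(B.chart i).map_source hx.1, by
    rw [Set.mem_preimage, (B.chart i).left_inv hx.1]; exact hx.2⟩

theorem change_mem {i j : ι} {z : ℂ} (hz : z ∈ B.overlap i j) : B.change i j z ∈ B.overlap j i :=
  B.mem_overlap ⟨hz.2, (B.chart i).map_target hz.1⟩

theorem symm_change {i j : ι} {z : ℂ} (hz : z ∈ B.overlap i j) :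
    (B.chart j).symm (B.change i j z) = (B.chart i).symm z :=
  (B.chart j).left_inv hz.2

theorem change_change {i j : ι} {z : ℂ} (hz : z ∈ B.overlap i j) :
    B.change j i (B.change i j z) = z := by
  rw [change, B.symm_change hz, (B.chart i).right_inv hz.1]

theorem image_overlap (i j : ι) : B.change i j '' B.overlap i j = B.overlap j i := by
  ext w
  constructor
  · rintro ⟨z, hz, rfl⟩
    exact B.change_mem hz
  · intro hw
    exact ⟨B.change j i w, B.change_mem hw, B.change_change hw⟩

theorem hasDerivAt_change [IsManifold 𝓘(ℂ) ω C] {i j : ι} {z : ℂ} (hz : z ∈ B.overlap i j) :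
    HasDerivAt (B.change i j) (B.jac i j ((B.chart i).symm z)) z := by
  have h1 : ContDiffOn ℂ ω (B.change i j) (B.overlap i j) := by
    have h := contDiffOn_transition (B.chart_mem i) (B.chart_mem j)
    rwa [OpenPartialHomeomorph.trans_source] at h
  rw [jac, (B.chart i).right_inv hz.1]
  exact ((h1.contDiffAt ((B.isOpen_overlap i j).mem_nhds hz)).differentiableAt
    (by simp)).hasDerivAt

open MeasureTheory in
theorem setIntegral_change [IsManifold 𝓘(ℂ) ω C] (i j : ι) (f : ℂ → ℂ) :
    ∫ z in B.overlap j i, f z = ∫ z in B.overlap i j,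
      (B.jac i j ((B.chart i).symm z) * star (B.jac i j ((B.chart i).symm z))) *
        f (B.change i j z) := by
  rw [← B.image_overlap i j,
    integral_image_eq_integral_abs_det_fderiv_smul volume (B.isOpen_overlap i j).measurableSet
      (fun z hz => ((B.hasDerivAt_change hz).hasFDerivAt.restrictScalars ℝ).hasFDerivWithinAt)
      (fun z hz w hw h => by rw [← B.change_change hz, h, B.change_change hw])]
  refine setIntegral_congr_fun (B.isOpen_overlap i j).measurableSet fun z _ => ?_
  generalize B.jac i j ((B.chart i).symm z) = d
  have hdet : ((ContinuousLinearMap.toSpanSingleton ℂ d).restrictScalars ℝ).det =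
      Complex.normSq d := by
    have : (((ContinuousLinearMap.toSpanSingleton ℂ d).restrictScalars ℝ : ℂ →L[ℝ] ℂ) :
        ℂ →ₗ[ℝ] ℂ) = LinearMap.mulLeft ℝ d := by
      ext; simp [mul_comm]
    rw [ContinuousLinearMap.det, this, ← Algebra.norm_complex_apply, Algebra.norm_apply]
    rfl
  simp only [hdet, abs_of_nonneg (Complex.normSq_nonneg d), Complex.real_smul,
    Complex.star_def, Complex.mul_conj]

end SmoothBundle

end HitchinMetric

namespace HitchinMetric

open MeasureTheory

variable {C : Type*} [TopologicalSpace C] [T2Space C] [CompactSpace C] [ChartedSpace ℂ C]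
  [IsManifold 𝓘(ℂ) ω C] {n : ℕ} {ι : Type*} (B : SmoothBundle C n ι)

/-- The function `i` of the partition of unity, in the coordinate `k`. -/
noncomputable def cutoff (i k : ι) (z : ℂ) : ℂ :=
  (((exists_partition B).choose i ((B.chart k).symm z) : ℝ) : ℂ)

/-- The support of the function `i` of the partition of unity, in the coordinate `i`. -/
noncomputable def cutoffSupport (i : ι) : Set ℂ :=
  B.chart i '' tsupport ((exists_partition B).choose i)

theorem cutoffSupport_subset (i : ι) : cutoffSupport B i ⊆ (B.chart i).target := by
  rintro _ ⟨x, hx, rfl⟩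
  exact (B.chart i).map_source ((exists_partition B).choose_spec i hx)

theorem isCompact_cutoffSupport (i : ι) : IsCompact (cutoffSupport B i) :=
  (isClosed_tsupport _).isCompact.image_of_continuousOn
    ((B.chart i).continuousOn.mono ((exists_partition B).choose_spec i))

theorem contDiffOn_cutoff (i k : ι) : ContDiffOn ℝ ∞ (cutoff B i k) (B.chart k).target := by
  have h1 : ContMDiffOn 𝓘(ℝ, ℂ) 𝓘(ℝ, ℂ) ∞ (B.chart k).symm (B.chart k).target :=
    contMDiffOn_symm_of_mem_maximalAtlas (mem_maximalAtlas_real (B.chart_mem k))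
  have h2 : ContMDiff 𝓘(ℝ, ℂ) 𝓘(ℝ, ℝ) ∞ ((exists_partition B).choose i) :=
    ((exists_partition B).choose i).contMDiff
  have h3 : ContDiffOn ℝ ∞ (fun z => (exists_partition B).choose i ((B.chart k).symm z))
      (B.chart k).target := contMDiffOn_iff_contDiffOn.1 (h2.comp_contMDiffOn h1)
  exact Complex.ofRealCLM.contDiff.comp_contDiffOn h3

/-- Away from its support the function `i` of the partition of unity vanishes locally. -/
theorem cutoff_eventuallyEq_zero {i k : ι} {z : ℂ} (hz : z ∈ (B.chart k).target)
    (h : (B.chart k).symm z ∉ tsupport ((exists_partition B).choose i)) :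
    cutoff B i k =ᶠ[nhds z] fun _ => 0 := by
  have h1 := ((B.chart k).continuousAt_symm hz).eventually
    ((isClosed_tsupport _).isOpen_compl.mem_nhds h)
  filter_upwards [h1] with w hw
  simp [cutoff, image_eq_zero_of_notMem_tsupport hw]

theorem notMem_tsupport_of_notMem_cutoffSupport {i : ι} {z : ℂ} (hz : z ∈ (B.chart i).target)
    (h : z ∉ cutoffSupport B i) :
    (B.chart i).symm z ∉ tsupport ((exists_partition B).choose i) := fun h' =>
  h ⟨_, h', (B.chart i).right_inv hz⟩

theorem notMem_tsupport_of_notMem_overlap {i k : ι} {z : ℂ} (hz : z ∈ (B.chart k).target)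
    (h : z ∉ B.overlap k i) :
    (B.chart k).symm z ∉ tsupport ((exists_partition B).choose i) := fun h' =>
  h ⟨hz, (exists_partition B).choose_spec i h'⟩

theorem cutoff_change {i j k : ι} {z : ℂ} (hz : z ∈ B.overlap j k) :
    cutoff B i k (B.change j k z) = cutoff B i j z := by
  rw [cutoff, B.symm_change hz, cutoff]

theorem integrableOn_of_cutoff {i : ι} {u : ℂ → ℂ} (hu : ContinuousOn u (B.chart i).target)
    (h0 : ∀ z ∈ (B.chart i).target, cutoff B i i =ᶠ[nhds z] (fun _ => 0) → u z = 0) :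
    IntegrableOn u (B.chart i).target :=
  integrableOn_of_eq_zero_off_compact (B.chart i).open_target (isCompact_cutoffSupport B i)
    (cutoffSupport_subset B i) hu fun z hz hzK => h0 z hz (cutoff_eventuallyEq_zero B hz
      (notMem_tsupport_of_notMem_cutoffSupport B hz hzK))

theorem finite_cutoff :
    {i | (Function.support ((exists_partition B).choose i)).Nonempty}.Finite :=
  (exists_partition B).choose.locallyFinite.finite_nonempty_of_compact

/-- The indices of the functions of the partition of unity that do not vanish. -/
noncomputable def cutoffIndex : Finset ι := (finite_cutoff B).toFinset

theorem cutoff_eq_zero {i k : ι} (hi : i ∉ cutoffIndex B) (z : ℂ) : cutoff B i k z = 0 := by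
  by_contra h
  refine hi ((finite_cutoff B).mem_toFinset.2 ⟨(B.chart k).symm z, fun h' => h ?_⟩)
  simp [cutoff, h']

theorem sum_cutoff (k : ι) (z : ℂ) : ∑ i ∈ cutoffIndex B, cutoff B i k z = 1 := by
  have h1 := (exists_partition B).choose.sum_eq_one (Set.mem_univ ((B.chart k).symm z))
  rw [finsum_eq_sum_of_support_subset (s := cutoffIndex B)] at h1
  · simp only [cutoff, ← Complex.ofReal_sum, h1, Complex.ofReal_one]
  · intro i hi
    rw [Finset.mem_coe]
    by_contra h
    have := cutoff_eq_zero B (k := k) h z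
    rw [cutoff, Complex.ofReal_eq_zero] at this
    exact hi this

theorem integralForm_eq_sum (w : ι → ℂ → ℂ) :
    integralForm B w = ∑ i ∈ cutoffIndex B,
      ∫ z in (B.chart i).target, cutoff B i i z * (-2 * Complex.I * w i z) := by
  refine finsum_eq_sum_of_support_subset _ fun i hi => ?_
  rw [Finset.mem_coe]
  by_contra h
  refine hi ?_
  have h0 := cutoff_eq_zero B (k := i) h
  simp only [cutoff] at h0
  simp [h0]

theorem integralForm_congr {w w' : ι → ℂ → ℂ}
    (h : ∀ i, ∀ z ∈ (B.chart i).target, w i z = w' i z) : integralForm B w = integralForm B w' := by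
  refine finsum_congr fun i => setIntegral_congr_fun (B.chart i).open_target.measurableSet ?_
  intro z hz
  simp only [h i z hz]

theorem integrableOn_cutoff_mul {i : ι} {w : ℂ → ℂ} (hw : ContinuousOn w (B.chart i).target) :
    IntegrableOn (fun z => cutoff B i i z * (-2 * Complex.I * w z)) (B.chart i).target :=
  integrableOn_of_cutoff B ((contDiffOn_cutoff B i i).continuousOn.mul
    (continuousOn_const.mul hw)) fun z _ h => by simp [h.self_of_nhds]

theorem integralForm_sub {w w' : ι → ℂ → ℂ}
    (hw : ∀ i, ContinuousOn (w i) (B.chart i).target)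
    (hw' : ∀ i, ContinuousOn (w' i) (B.chart i).target) :
    integralForm B (fun i z => w i z - w' i z) = integralForm B w - integralForm B w' := by
  simp only [integralForm_eq_sum, ← Finset.sum_sub_distrib]
  refine Finset.sum_congr rfl fun i _ => ?_
  rw [← integral_sub (integrableOn_cutoff_mul B (hw i)) (integrableOn_cutoff_mul B (hw' i))]
  simp only [mul_sub]

theorem integralForm_const_mul (c : ℂ) (w : ι → ℂ → ℂ) :
    integralForm B (fun i z => c * w i z) = c * integralForm B w := by
  simp only [integralForm_eq_sum, Finset.mul_sum, ← integral_const_mul]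
  refine Finset.sum_congr rfl fun i _ => integral_congr_ae (.of_forall fun z => ?_)
  simp only
  ring

/-- The reality of the 2-form `w` is `star w = -w`, as `dz ∧ dz̄` is imaginary. -/
theorem star_integralForm (w : ι → ℂ → ℂ) :
    star (integralForm B w) = integralForm B (fun i z => -star (w i z)) := by
  simp only [integralForm_eq_sum, star_sum, Complex.star_def, ← integral_conj]
  refine Finset.sum_congr rfl fun i _ => integral_congr_ae (.of_forall fun z => ?_)
  simp [cutoff, map_ofNat (starRingEnd ℂ) 2]

theorem setIntegral_overlap {i k : ι} {f : ℂ → ℂ}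
    (h0 : ∀ z ∈ (B.chart i).target, cutoff B k i =ᶠ[nhds z] (fun _ => 0) → f z = 0) :
    ∫ z in B.overlap i k, f z = ∫ z in (B.chart i).target, f z :=
  (setIntegral_eq_of_subset_of_forall_sdiff_eq_zero (B.chart i).open_target.measurableSet
    Set.inter_subset_left fun z hz => h0 z hz.1 (cutoff_eventuallyEq_zero B hz.1
      (notMem_tsupport_of_notMem_overlap B hz.1 hz.2))).symm

/-- The integral of `χ_k (∂χ_i) ∧ q`, for the partition of unity `χ`, may be taken in the
coordinate `i` or in the coordinate `k`. -/
theorem setIntegral_cutoff_mul_wirtDz {q : ι → ℂ → ℂ}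
    (hc : ∀ i j, ∀ x ∈ (B.chart i).source ∩ (B.chart j).source,
      q i (B.chart i x) = star (B.jac i j x) * q j (B.chart j x)) (i k : ι) :
    ∫ z in (B.chart i).target, cutoff B k i z * wirtDz (cutoff B i i) z * q i z =
      ∫ z in (B.chart k).target, cutoff B k k z * wirtDz (cutoff B i k) z * q k z := by
  rw [← setIntegral_overlap B (k := k) fun z _ h => by simp [h.self_of_nhds],
    ← setIntegral_overlap B (k := i) fun z _ h => by rw [wirtDz_congr h, wirtDz_const]; simp,
    B.setIntegral_change i k]
  refine setIntegral_congr_fun (B.isOpen_overlap i k).measurableSet fun z hz => ?_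
  have h1 : wirtDz (cutoff B i i) z = B.jac i k ((B.chart i).symm z) *
      wirtDz (cutoff B i k) (B.change i k z) := by
    rw [← wirtDz_comp (B.hasDerivAt_change hz) (((contDiffOn_cutoff B i k).contDiffAt
      ((B.chart k).open_target.mem_nhds (B.change_mem hz).1)).differentiableAt (by simp))]
    refine wirtDz_congr ?_
    filter_upwards [(B.isOpen_overlap i k).mem_nhds hz] with w hw
    rw [cutoff_change B hw]
  have h2 : q i z = star (B.jac i k ((B.chart i).symm z)) * q k (B.change i k z) := by
    have h := hc i k _ (B.symm_mem hz)
    rwa [(B.chart i).right_inv hz.1] at h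
  simp only [cutoff_change B hz, h1, h2]
  ring

/-- Stokes' theorem for a `(0,1)`-form `q i dz̄_i`. -/
theorem integralForm_wirtDz {q : ι → ℂ → ℂ}
    (hq : ∀ i, ContDiffOn ℝ ∞ (q i) (B.chart i).target)
    (hc : ∀ i j, ∀ x ∈ (B.chart i).source ∩ (B.chart j).source,
      q i (B.chart i x) = star (B.jac i j x) * q j (B.chart j x)) :
    integralForm B (fun i z => wirtDz (q i) z) = 0 := by
  have hU : ∀ i, IsOpen (B.chart i).target := fun i => (B.chart i).open_target
  have hd : ∀ i k, ContinuousOn (wirtDz (cutoff B i k)) (B.chart k).target := fun i k =>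
    (contDiffOn_wirtDz (hU k) (contDiffOn_cutoff B i k)).continuousOn
  have hχ : ∀ i k, ContinuousOn (cutoff B i k) (B.chart k).target := fun i k =>
    (contDiffOn_cutoff B i k).continuousOn
  have hparts : ∀ i, ∫ z in (B.chart i).target, cutoff B i i z * (-2 * Complex.I * wirtDz (q i) z) =
      2 * Complex.I * ∫ z in (B.chart i).target, wirtDz (cutoff B i i) z * q i z := by
    intro i
    have i1 : IntegrableOn (fun z => wirtDz (cutoff B i i) z * q i z) (B.chart i).target :=
      integrableOn_of_cutoff B ((hd i i).mul (hq i).continuousOn) fun z _ h => by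
        rw [wirtDz_congr h, wirtDz_const, zero_mul]
    have i2 : IntegrableOn (fun z => cutoff B i i z * wirtDz (q i) z) (B.chart i).target :=
      integrableOn_of_cutoff B ((hχ i i).mul (contDiffOn_wirtDz (hU i) (hq i)).continuousOn)
        fun z _ h => by simp [h.self_of_nhds]
    have h0 := setIntegral_wirtDz_eq_zero (u := fun z => cutoff B i i z * q i z) (hU i)
      (isCompact_cutoffSupport B i) (cutoffSupport_subset B i)
      ((contDiffOn_cutoff B i i).mul (hq i)) fun z hz hzK => by
        rw [(cutoff_eventuallyEq_zero B hz
          (notMem_tsupport_of_notMem_cutoffSupport B hz hzK)).self_of_nhds, zero_mul]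
    have h1 : ∫ z in (B.chart i).target, wirtDz (fun w => cutoff B i i w * q i w) z =
        (∫ z in (B.chart i).target, wirtDz (cutoff B i i) z * q i z) +
          ∫ z in (B.chart i).target, cutoff B i i z * wirtDz (q i) z := by
      rw [← integral_add i1 i2]
      exact setIntegral_congr_fun (hU i).measurableSet fun z hz => wirtDz_mul
        (((contDiffOn_cutoff B i i).contDiffAt ((hU i).mem_nhds hz)).differentiableAt (by simp))
        (((hq i).contDiffAt ((hU i).mem_nhds hz)).differentiableAt (by simp))
    have h2 : ∫ z in (B.chart i).target, cutoff B i i z * (-2 * Complex.I * wirtDz (q i) z) =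
        -2 * Complex.I * ∫ z in (B.chart i).target, cutoff B i i z * wirtDz (q i) z := by
      rw [← integral_const_mul]
      exact integral_congr_ae (.of_forall fun z => by simp only; ring)
    rw [h2]
    linear_combination (-2 * Complex.I) * (h0.symm.trans h1).symm
  have hsplit : ∀ i, ∫ z in (B.chart i).target, wirtDz (cutoff B i i) z * q i z =
      ∑ k ∈ cutoffIndex B,
        ∫ z in (B.chart k).target, cutoff B k k z * wirtDz (cutoff B i k) z * q k z := by
    intro i
    simp only [← setIntegral_cutoff_mul_wirtDz B hc]
    rw [← integral_finsetSum (f := fun k z => cutoff B k i z * wirtDz (cutoff B i i) z * q i z) _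
      fun k _ => integrableOn_of_cutoff B (((hχ k i).mul (hd i i)).mul (hq i).continuousOn) fun z _ h => by
        rw [wirtDz_congr h, wirtDz_const, mul_zero, zero_mul]]
    refine integral_congr_ae (.of_forall fun z => ?_)
    simp only [← Finset.sum_mul, sum_cutoff, one_mul]
  rw [integralForm_eq_sum]
  simp only [hparts, hsplit, ← Finset.mul_sum]
  rw [Finset.sum_comm, Finset.sum_eq_zero fun k _ => ?_, mul_zero]
  rw [← integral_finsetSum (f := fun i z => cutoff B k k z * wirtDz (cutoff B i k) z * q k z) _
    fun i _ => integrableOn_of_cutoff B (((hχ k k).mul (hd i k)).mul (hq k).continuousOn) fun z _ h => by simp [h.self_of_nhds]]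
  refine setIntegral_eq_zero_of_forall_eq_zero fun z hz => ?_
  rw [← Finset.sum_mul, ← Finset.mul_sum, ← wirtDz_sum fun i _ =>
    ((contDiffOn_cutoff B i k).contDiffAt ((hU k).mem_nhds hz)).differentiableAt (by simp)]
  simp only [sum_cutoff, wirtDz_const, mul_zero, zero_mul]

end HitchinMetric

namespace HitchinMetric

/-! ### Pointwise identities -/

section Pointwise

variable {n : ℕ}

theorem ip01_eq (h Q₁ Q₂ : Mat n) : ip01 h Q₁ Q₂ = Complex.I * (Q₁ * adj h Q₂).trace := by
  simp [ip01]

theorem ip10_eq (h P₁ P₂ : Mat n) : ip10 h P₁ P₂ = Complex.I * (P₁ * adj h P₂).trace := by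
  simp [ip10]

theorem ip01_add_ip10_eq (h Q₁ Q₂ P₁ P₂ : Mat n) : ip01 h Q₁ Q₂ + ip10 h P₁ P₂ =
    Complex.I * ((Q₁ * adj h Q₂).trace + (P₁ * adj h P₂).trace) := by
  rw [ip01_eq, ip10_eq, mul_add]

theorem adj_neg (h X : Mat n) : adj h (-X) = -adj h X := by simp [adj]

theorem adj_sub (h X Y : Mat n) : adj h (X - Y) = adj h X - adj h Y := by
  simp [adj, mul_sub, sub_mul]

theorem adj_mul {h : Mat n} (H : h.PosDef) (X Y : Mat n) : adj h (X * Y) = adj h Y * adj h X := by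
  have hu : IsUnit h.det := H.det_pos.ne'.isUnit
  simp only [adj, Matrix.conjTranspose_mul, Matrix.mul_assoc,
    Matrix.mul_nonsing_inv_cancel_left _ _ hu]

theorem star_trace_mul_adj {h : Mat n} (H : h.PosDef) (X Y : Mat n) :
    star (X * adj h Y).trace = (Y * adj h X).trace := by
  rw [← Matrix.trace_conjTranspose, adj, adj, Matrix.conjTranspose_mul, Matrix.conjTranspose_mul,
    Matrix.conjTranspose_mul, Matrix.conjTranspose_conjTranspose, Matrix.conjTranspose_nonsing_inv,
    H.isHermitian.eq, Matrix.mul_assoc, Matrix.trace_mul_comm]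
  simp only [Matrix.mul_assoc]

theorem adj_congr_frame {h T : Mat n} (hT : IsUnit T.det) (X : Mat n) :
    adj (Tᴴ * h * T) (T⁻¹ * X * T) = T⁻¹ * adj h X * T := by
  have hT' : IsUnit (Tᴴ).det := by rw [Matrix.det_conjTranspose]; exact hT.star
  simp only [adj, Matrix.mul_inv_rev, Matrix.conjTranspose_mul, Matrix.conjTranspose_nonsing_inv,
    Matrix.mul_assoc, Matrix.nonsing_inv_mul_cancel_left _ _ hT']

theorem IsPosSqrt.trace_conj {h₀ h S : Mat n} (H₀ : h₀.PosDef) (hS : IsPosSqrt h₀ h S)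
    (X Y : Mat n) :
    (S * X * S⁻¹ * adj h₀ (S * Y * S⁻¹)).trace = (X * adj h Y).trace := by
  have hu : IsUnit S.det := hS.det_ne_zero.isUnit
  rw [hS.adj_conj H₀, Matrix.mul_assoc, Matrix.mul_assoc, Matrix.mul_assoc,
    Matrix.nonsing_inv_mul_cancel_left _ _ hu, Matrix.trace_mul_comm]
  simp only [Matrix.mul_assoc, Matrix.nonsing_inv_mul _ hu, Matrix.mul_one]

theorem IsPosSqrt.congr_frame {h₀ h S T : Mat n} (hT : IsUnit T.det) (hS : IsPosSqrt h₀ h S) :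
    IsPosSqrt (Tᴴ * h₀ * T) (Tᴴ * h * T) (T⁻¹ * S * T) := by
  have hT' : IsUnit (Tᴴ).det := by rw [Matrix.det_conjTranspose]; exact hT.star
  constructor
  · have h1 := hS.1.conjTranspose_mul_mul_same (B := T)
      (Matrix.mulVec_injective_of_isUnit ((Matrix.isUnit_iff_isUnit_det T).2 hT))
    convert h1 using 1
    simp only [Matrix.mul_assoc, Matrix.mul_nonsing_inv_cancel_left _ _ hT]
  · calc T⁻¹ * S * T * (T⁻¹ * S * T) = T⁻¹ * (S * S) * T := by
          simp only [Matrix.mul_assoc, Matrix.mul_nonsing_inv_cancel_left _ _ hT]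
      _ = _ := by
          rw [hS.2]
          simp only [Matrix.mul_inv_rev, Matrix.mul_assoc,
            Matrix.nonsing_inv_mul_cancel_left _ _ hT']

variable {α h X S : ℂ → Mat n} {z : ℂ}

theorem MatDiffAt.sub {A A' : ℂ → Mat n} (hA : MatDiffAt A z) (hA' : MatDiffAt A' z) :
    MatDiffAt (fun w => A w - A' w) z :=
  fun a b => (hA a b).sub (hA' a b)

theorem matDz_sub {A A' : ℂ → Mat n} (hA : MatDiffAt A z) (hA' : MatDiffAt A' z) :
    matDz (fun w => A w - A' w) z = matDz A z - matDz A' z := by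
  have h1 := fun a b => wirtDz_add ((hA.sub hA') a b) (hA' a b)
  ext a b
  have h2 := h1 a b
  simp only [Matrix.sub_apply, sub_add_cancel] at h2
  simp only [matDz, Matrix.of_apply, Matrix.sub_apply, h2, add_sub_cancel_right]

theorem delForm01_sub {A A' : ℂ → Mat n} (hA : MatDiffAt A z) (hA' : MatDiffAt A' z) :
    delForm01 α h (fun w => A w - A' w) z = delForm01 α h A z - delForm01 α h A' z := by
  simp only [delForm01, matDz_sub hA hA', comm, mul_sub, sub_mul]
  abel

/-- `(∂̄_E X)^{†_h} = ∂_E^h (X^{†_h})`. -/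
theorem adj_dbarEnd (H : (h z).PosDef) (hh : MatDiffAt h z) (hX : MatDiffAt X z)
    (hpos : ∀ᶠ w in nhds z, (h w).PosDef) (hY : MatDiffAt (fun w => adj (h w) (X w)) z) :
    adj (h z) (dbarEnd α X z) = delForm01 α h (fun w => adj (h w) (X w)) z := by
  have hu : IsUnit (h z).det := H.det_pos.ne'.isUnit
  have e1 : (fun w => h w * adj (h w) (X w)) =ᶠ[nhds z] fun w => (X w)ᴴ * h w := by
    filter_upwards [hpos] with w hw
    rw [adj, Matrix.mul_assoc, Matrix.mul_nonsing_inv_cancel_left _ _ hw.det_pos.ne'.isUnit]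
  have e2 := matDz_congr e1
  rw [matDz_mul hh hY, matDz_mul hX.conjTranspose hh, matDz_conjTranspose hX] at e2
  have e3 : matDz (fun w => adj (h w) (X w)) z = (h z)⁻¹ *
      ((matDzbar X z)ᴴ * h z + (X z)ᴴ * matDz h z - matDz h z * adj (h z) (X z)) := by
    rw [← e2, add_sub_cancel_left, Matrix.nonsing_inv_mul_cancel_left _ _ hu]
  rw [delForm01, e3]
  simp only [adj, dbarEnd, comm, chern10, Matrix.conjTranspose_add, Matrix.conjTranspose_sub,
    Matrix.conjTranspose_mul, Matrix.mul_add, Matrix.mul_sub, Matrix.add_mul, Matrix.sub_mul,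
    Matrix.mul_assoc, Matrix.mul_nonsing_inv_cancel_left _ _ hu]
  abel

/-- Conjugation by `S` turns `∂̄ + α dz̄` into `S ∘ (∂̄ + α dz̄) ∘ S⁻¹`. -/
theorem dbarEnd_conj (hS : MatDiffAt S z) (hX : MatDiffAt X z)
    (hSi : MatDiffAt (fun w => (S w)⁻¹) z) (hu : ∀ᶠ w in nhds z, IsUnit (S w).det) :
    dbarEnd (fun w => S w * α w * (S w)⁻¹ + S w * matDzbar (fun v => (S v)⁻¹) w) X z =
      S z * dbarEnd α (fun w => (S w)⁻¹ * X w * S w) z * (S z)⁻¹ := by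
  have hu0 : IsUnit (S z).det := hu.self_of_nhds
  have e1 : (fun w => (S w)⁻¹ * S w) =ᶠ[nhds z] fun _ => 1 := by
    filter_upwards [hu] with w hw
    exact Matrix.nonsing_inv_mul _ hw
  have e2 := matDzbar_congr e1
  rw [matDzbar_const, matDzbar_mul hSi hS] at e2
  have e3 : matDzbar S z = -(S z * (matDzbar (fun w => (S w)⁻¹) z * S z)) := by
    rw [eq_neg_of_add_eq_zero_left e2, mul_neg, neg_neg,
      Matrix.mul_nonsing_inv_cancel_left _ _ hu0]
  simp only [dbarEnd, comm]
  rw [matDzbar_mul (hSi.mul hX) hS, matDzbar_mul hSi hX, e3]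
  simp only [Matrix.mul_add, Matrix.mul_sub, Matrix.add_mul, Matrix.sub_mul, Matrix.mul_assoc,
    Matrix.mul_nonsing_inv_cancel_left _ _ hu0,
    Matrix.mul_nonsing_inv _ hu0, Matrix.mul_one, mul_neg, neg_mul]
  abel

end Pointwise

end HitchinMetric

namespace HitchinMetric

/-! ### Global sections and the Coulomb gauge -/

section Frames

variable {C : Type*} [TopologicalSpace C] [ChartedSpace ℂ C] {n : ℕ} {ι : Type*}
  {B : SmoothBundle C n ι}

theorem SmoothBundle.trans_mul_trans (B : SmoothBundle C n ι) {i j : ι} {x : C}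
    (hx : x ∈ (B.chart i).source ∩ (B.chart j).source) : B.trans j i x * B.trans i j x = 1 := by
  rw [B.source_eq, B.source_eq] at hx
  rw [SmoothBundle.trans, SmoothBundle.trans, ← LinearMap.toMatrix'_comp,
    ← LinearMap.toMatrix'_id]
  congr 1
  ext1 v
  have h1 := B.core.coordChange_comp i j i x ⟨hx, hx.1⟩
  refine LinearMap.ext fun w => ?_
  simpa using (h1 (Pi.single v w)).trans (B.core.coordChange_self i x hx.1 _)

theorem SmoothBundle.isUnit_det_trans (B : SmoothBundle C n ι) {i j : ι} {x : C}
    (hx : x ∈ (B.chart i).source ∩ (B.chart j).source) : IsUnit (B.trans i j x).det :=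
  Matrix.isUnit_det_of_left_inverse (B.trans_mul_trans hx)

theorem SmoothBundle.smoothMatOn_trans (B : SmoothBundle C n ι) (i j : ι) :
    SmoothMatOn (fun z => B.trans i j ((B.chart i).symm z)) (B.overlap i j) :=
  B.smooth_coordChange i j

theorem EndSection.smoothFamily_dbarEnd (D : HolStructure B) (γ : EndSection B) :
    SmoothFamily B fun i => dbarEnd (D.coeff i) (γ.coeff i) := fun i =>
  SmoothMatOn.add (SmoothMatOn.matDzbar (γ.smooth i) (B.chart i).open_target)
    (SmoothMatOn.comm (D.smooth i) (γ.smooth i))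

theorem EndSection.coeff_eq (γ : EndSection B) {i j : ι} {x : C}
    (hx : x ∈ (B.chart i).source ∩ (B.chart j).source) :
    γ.coeff i (B.chart i x) = (B.trans i j x)⁻¹ * γ.coeff j (B.chart j x) * B.trans i j x := by
  rw [Matrix.mul_assoc, γ.compat i j x hx,
    Matrix.nonsing_inv_mul_cancel_left _ _ (B.isUnit_det_trans hx)]

/-- `∂̄_E γ` is a `(0,1)`-form. -/
theorem EndSection.dbarEnd_compat [IsManifold 𝓘(ℂ) ω C] (D : HolStructure B) (γ : EndSection B)
    (i j : ι) (x : C) (hx : x ∈ (B.chart i).source ∩ (B.chart j).source) :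
    star (B.jac i j x) • dbarEnd (D.coeff j) (γ.coeff j) (B.chart j x) * B.trans i j x =
      B.trans i j x * dbarEnd (D.coeff i) (γ.coeff i) (B.chart i x) := by
  have hz := B.mem_overlap hx
  have hsx : (B.chart i).symm (B.chart i x) = x := (B.chart i).left_inv hx.1
  have hc : B.change i j (B.chart i x) = B.chart j x := by rw [SmoothBundle.change, hsx]
  have hψ := B.hasDerivAt_change hz
  rw [hsx] at hψ
  set T : ℂ → Mat n := fun z => B.trans i j ((B.chart i).symm z) with hTdef
  have hT : MatDiffAt T (B.chart i x) :=
    (B.smoothMatOn_trans i j).matDiffAt (B.isOpen_overlap i j) hz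
  have hTx : T (B.chart i x) = B.trans i j x := by simp only [hTdef, hsx]
  have hγj : MatDiffAt (γ.coeff j) (B.change i j (B.chart i x)) :=
    SmoothMatOn.matDiffAt (γ.smooth j) (B.chart j).open_target (B.change_mem hz).1
  have hγi : MatDiffAt (γ.coeff i) (B.chart i x) :=
    SmoothMatOn.matDiffAt (γ.smooth i) (B.chart i).open_target hz.1
  have hγψ : MatDiffAt (fun w => γ.coeff j (B.change i j w)) (B.chart i x) := fun a b =>
    (hγj a b).comp _ (hψ.hasFDerivAt.restrictScalars ℝ).differentiableAt
  have e1 : (fun w => γ.coeff j (B.change i j w) * T w) =ᶠ[nhds (B.chart i x)]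
      fun w => T w * γ.coeff i w := by
    filter_upwards [(B.isOpen_overlap i j).mem_nhds hz] with w hw
    have h := γ.compat i j _ (B.symm_mem hw)
    rwa [(B.chart i).right_inv hw.1] at h
  have e2 := matDzbar_congr e1
  rw [matDzbar_mul hγψ hT, matDzbar_mul hT hγi, matDzbar_comp hψ hγj, hc, hTx] at e2
  have e3 := D.compat i j x hx
  have e4 := γ.compat i j x hx
  have e5 := eq_sub_of_add_eq' e3
  have e6 := eq_sub_of_add_eq e2
  simp only [dbarEnd, comm, smul_add, smul_sub, add_mul, sub_mul]
  rw [e6]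
  have e7 : star (B.jac i j x) • (D.coeff j (B.chart j x) * γ.coeff j (B.chart j x)) *
      B.trans i j x = (star (B.jac i j x) • D.coeff j (B.chart j x) * B.trans i j x) *
        γ.coeff i (B.chart i x) := by
    rw [Matrix.mul_assoc (star (B.jac i j x) • D.coeff j (B.chart j x)), ← e4]
    simp only [Matrix.smul_mul, Matrix.mul_assoc]
  have e8 : star (B.jac i j x) • (γ.coeff j (B.chart j x) * D.coeff j (B.chart j x)) *
      B.trans i j x = γ.coeff j (B.chart j x) *
        (star (B.jac i j x) • D.coeff j (B.chart j x) * B.trans i j x) := by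
    simp only [Matrix.smul_mul, Matrix.mul_smul, Matrix.mul_assoc]
  rw [e7, e8, e5]
  simp only [sub_mul, mul_sub, mul_add, ← Matrix.mul_assoc, e4]
  abel

theorem etaMinus_compat [IsManifold 𝓘(ℂ) ω C] (D : HolStructure B) (η' : Form01 B)
    (ν' : EndSection B) (i j : ι) (x : C) (hx : x ∈ (B.chart i).source ∩ (B.chart j).source) :
    star (B.jac i j x) • etaMinus D η' ν' j (B.chart j x) * B.trans i j x =
      B.trans i j x * etaMinus D η' ν' i (B.chart i x) := by
  rw [etaMinus, etaMinus, smul_sub, sub_mul, mul_sub, η'.compat i j x hx,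
    ν'.dbarEnd_compat D i j x hx]

theorem smoothFamily_etaMinus (D : HolStructure B) (η' : Form01 B) (ν' : EndSection B) :
    SmoothFamily B (etaMinus D η' ν') := fun i =>
  SmoothMatOn.sub (η'.smooth i) (ν'.smoothFamily_dbarEnd D i)

theorem smoothFamily_phiPlus (φ φ' : Form10 B) (ν' : EndSection B) :
    SmoothFamily B (phiPlus φ φ' ν') := fun i =>
  SmoothMatOn.add (φ'.smooth i) (SmoothMatOn.comm (ν'.smooth i) (φ.smooth i))

section Root

variable (h₀ h : HermMetric B)

theorem HermMetric.isPosSqrt_rootH {i : ι} {z : ℂ} (hz : z ∈ (B.chart i).target) :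
    IsPosSqrt (h₀.coeff i z) (h.coeff i z) (rootH h₀ h i z) :=
  isPosSqrt_sqrtH (h₀.posDef i z hz) (h.posDef i z hz)

theorem HermMetric.isUnit_det_rootH {i : ι} {z : ℂ} (hz : z ∈ (B.chart i).target) :
    IsUnit (rootH h₀ h i z).det :=
  (h₀.isPosSqrt_rootH h hz).det_ne_zero.isUnit

open scoped MatrixOrder in
theorem HermMetric.smooth_rootH : SmoothFamily B (rootH h₀ h) := by
  intro i
  have hU := (B.chart i).open_target
  have hR : SmoothMatOn (fun z => CFC.sqrt (h₀.coeff i z)) (B.chart i).target :=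
    smoothMatOn_sqrt hU (h₀.smooth i) (h₀.posDef i)
  have hRi := hR.inv fun z hz => (posDef_sqrt (h₀.posDef i z hz)).det_pos.ne'
  have hK := (hRi.mul (h.smooth i)).mul hRi
  have hKpos : ∀ z ∈ (B.chart i).target, ((CFC.sqrt (h₀.coeff i z))⁻¹ * h.coeff i z *
      (CFC.sqrt (h₀.coeff i z))⁻¹).PosDef := fun z hz => by
    have hp := posDef_sqrt (h₀.posDef i z hz)
    have h1 := (h.posDef i z hz).conjTranspose_mul_mul_same (B := (CFC.sqrt (h₀.coeff i z))⁻¹)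
      (Matrix.mulVec_injective_of_isUnit hp.inv.isUnit)
    rwa [hp.inv.isHermitian.eq] at h1
  exact SmoothMatOn.congr ((hRi.mul (smoothMatOn_sqrt hU hK hKpos)).mul hR) fun z hz =>
    (h₀.isPosSqrt_rootH h hz).eq (h₀.posDef i z hz)

theorem HermMetric.smooth_rootH_inv : SmoothFamily B fun i z => (rootH h₀ h i z)⁻¹ := fun i =>
  SmoothMatOn.inv (h₀.smooth_rootH h i) fun _ hz => (h₀.isPosSqrt_rootH h hz).det_ne_zero

theorem HermMetric.rootH_eq {i j : ι} {x : C}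
    (hx : x ∈ (B.chart i).source ∩ (B.chart j).source) :
    rootH h₀ h i (B.chart i x) =
      (B.trans i j x)⁻¹ * rootH h₀ h j (B.chart j x) * B.trans i j x := by
  have hi := (B.chart i).map_source hx.1
  have h1 := h₀.isPosSqrt_rootH h hi
  refine h1.unique (h₀.posDef i _ hi) ?_
  rw [← h₀.compat i j x hx, ← h.compat i j x hx]
  exact (h₀.isPosSqrt_rootH h ((B.chart j).map_source hx.2)).congr_frame (B.isUnit_det_trans hx)

/-- The section `H^{-1/2} δ H^{1/2}`. -/
noncomputable def HermMetric.conjSection (δ : EndSection B) : EndSection B where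
  coeff i z := (rootH h₀ h i z)⁻¹ * δ.coeff i z * rootH h₀ h i z
  smooth i := SmoothMatOn.mul (SmoothMatOn.mul (h₀.smooth_rootH_inv h i) (δ.smooth i))
    (h₀.smooth_rootH h i)
  compat i j x hx := by
    have hT := B.isUnit_det_trans hx
    rw [h₀.rootH_eq h hx, δ.coeff_eq hx]
    simp only [Matrix.mul_inv_rev, Matrix.nonsing_inv_nonsing_inv _ hT, Matrix.mul_assoc,
      Matrix.mul_nonsing_inv_cancel_left _ _ hT]

/-- The pair `H^{1/2} X H^{-1/2}`. -/
noncomputable def HermMetric.conjPair (X : FormPair ι n) : FormPair ι n :=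
  (fun i z => rootH h₀ h i z * X.1 i z * (rootH h₀ h i z)⁻¹,
   fun i z => rootH h₀ h i z * X.2 i z * (rootH h₀ h i z)⁻¹)

end Root

/-- Equality of pairs of forms, on the ranges of the coordinates. -/
def PairEq (B : SmoothBundle C n ι) (X Y : FormPair ι n) : Prop :=
  ∀ i, ∀ z ∈ (B.chart i).target, X.1 i z = Y.1 i z ∧ X.2 i z = Y.2 i z

theorem pairEq_infAction (D : HolStructure B) (φ : Form10 B) (h₀ h : HermMetric B)
    (δ : EndSection B) :
    PairEq B (infAction (unitaryDbar D h₀ h) (unitaryHiggs φ h₀ h) δ)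
      (h₀.conjPair h (infAction D.coeff φ.coeff (h₀.conjSection h δ))) := by
  intro i z hz
  have hU := (B.chart i).open_target
  have hu := h₀.isUnit_det_rootH h hz
  constructor
  · have h1 := dbarEnd_conj (α := D.coeff i) (SmoothMatOn.matDiffAt (h₀.smooth_rootH h i) hU hz)
      (SmoothMatOn.matDiffAt (δ.smooth i) hU hz)
      (SmoothMatOn.matDiffAt (h₀.smooth_rootH_inv h i) hU hz)
      (Filter.mem_of_superset (hU.mem_nhds hz) fun w hw => h₀.isUnit_det_rootH h hw)
    simp only [infAction, HermMetric.conjPair, mul_neg, neg_mul]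
    exact congrArg Neg.neg h1
  · simp only [infAction, HermMetric.conjPair, HermMetric.conjSection, unitaryHiggs, comm,
      mul_sub, sub_mul, Matrix.mul_assoc, Matrix.mul_nonsing_inv_cancel_left _ _ hu,
      Matrix.mul_nonsing_inv _ hu, Matrix.mul_one]

theorem continuousOn_pairing (h : HermMetric B) {X Y : FormPair ι n}
    (hX : SmoothFamily B X.1 ∧ SmoothFamily B X.2) (hY : SmoothFamily B Y.1 ∧ SmoothFamily B Y.2)
    (i : ι) : ContinuousOn (fun z => ip01 (h.coeff i z) (X.1 i z) (Y.1 i z) +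
      ip10 (h.coeff i z) (X.2 i z) (Y.2 i z)) (B.chart i).target := by
  simp only [ip01_add_ip10_eq]
  exact continuousOn_const.mul
    ((SmoothMatOn.mul (hX.1 i) (SmoothMatOn.adj (h.smooth i) (h.posDef i) (hY.1 i))).trace.add
      (SmoothMatOn.mul (hX.2 i)
        (SmoothMatOn.adj (h.smooth i) (h.posDef i) (hY.2 i))).trace).continuousOn

theorem smooth_infAction (D : HolStructure B) (φ : Form10 B) (γ : EndSection B) :
    SmoothFamily B (infAction D.coeff φ.coeff γ).1 ∧
      SmoothFamily B (infAction D.coeff φ.coeff γ).2 :=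
  ⟨fun i a b => (γ.smoothFamily_dbarEnd D i a b).neg,
    fun i => SmoothMatOn.comm (γ.smooth i) (φ.smooth i)⟩

end Frames

section Pairing

variable {C : Type*} [TopologicalSpace C] [T2Space C] [CompactSpace C] [ChartedSpace ℂ C]
  [IsManifold 𝓘(ℂ) ω C] {n : ℕ} {ι : Type*} {B : SmoothBundle C n ι}

theorem integralPairing_congr (h : HermMetric B) {X X' Y Y' : FormPair ι n} (hX : PairEq B X X')
    (hY : PairEq B Y Y') : integralPairing h X Y = integralPairing h X' Y' :=
  integralForm_congr B fun i z hz => by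
    rw [(hX i z hz).1, (hX i z hz).2, (hY i z hz).1, (hY i z hz).2]

theorem integralPairing_conjPair (h₀ h : HermMetric B) (X Y : FormPair ι n) :
    integralPairing h₀ (h₀.conjPair h X) (h₀.conjPair h Y) = integralPairing h X Y :=
  integralForm_congr B fun i z hz => by
    have h1 := (h₀.isPosSqrt_rootH h hz).trace_conj (h₀.posDef i z hz)
    rw [ip01_add_ip10_eq, ip01_add_ip10_eq, ← h1, ← h1]
    rfl

theorem star_integralPairing (h : HermMetric B) (X Y : FormPair ι n) :
    star (integralPairing h X Y) = integralPairing h Y X := by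
  rw [integralPairing, star_integralForm]
  refine integralForm_congr B fun i z hz => ?_
  have h1 := star_trace_mul_adj (h.posDef i z hz)
  rw [ip01_add_ip10_eq, ip01_add_ip10_eq, star_mul', star_add, h1, h1]
  simp

theorem integralPairing_sub_right (h : HermMetric B) {X Y Z : FormPair ι n}
    (hX : SmoothFamily B X.1 ∧ SmoothFamily B X.2) (hY : SmoothFamily B Y.1 ∧ SmoothFamily B Y.2)
    (hZ : SmoothFamily B Z.1 ∧ SmoothFamily B Z.2) :
    integralPairing h X (Y - Z) = integralPairing h X Y - integralPairing h X Z := by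
  simp only [integralPairing]
  rw [← integralForm_sub B (continuousOn_pairing h hX hY) (continuousOn_pairing h hX hZ)]
  refine integralForm_congr B fun i z _ => ?_
  simp only [ip01_add_ip10_eq, Prod.fst_sub, Prod.snd_sub, Pi.sub_apply, adj_sub, mul_sub,
    Matrix.trace_sub]
  ring

theorem integralPairing_sub_left (h : HermMetric B) {X Y Z : FormPair ι n}
    (hX : SmoothFamily B X.1 ∧ SmoothFamily B X.2) (hY : SmoothFamily B Y.1 ∧ SmoothFamily B Y.2)
    (hZ : SmoothFamily B Z.1 ∧ SmoothFamily B Z.2) :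
    integralPairing h (X - Y) Z = integralPairing h X Z - integralPairing h Y Z := by
  rw [← star_integralPairing, integralPairing_sub_right h hZ hX hY, star_sub,
    star_integralPairing, star_integralPairing]

/-- A solution of the gauge equation is orthogonal to the complexified infinitesimal action: by
Stokes' theorem for `tr((η̇ - ∂̄_E ν̇) γ^{†_h})`. -/
theorem integralPairing_infAction_eq_zero {D : HolStructure B} {φ : Form10 B} {h : HermMetric B}
    {η' : Form01 B} {φ' : Form10 B} {ν' : EndSection B}
    (hgauge : SolvesGaugeEquation D φ h η' φ' ν') (γ : EndSection B) :
    integralPairing h (etaMinus D η' ν', phiPlus φ φ' ν') (infAction D.coeff φ.coeff γ) = 0 := by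
  have hadj : SmoothFamily B fun i z => adj (h.coeff i z) (γ.coeff i z) := fun i =>
    SmoothMatOn.adj (h.smooth i) (h.posDef i) (γ.smooth i)
  have hQ := smoothFamily_etaMinus D η' ν'
  have hStokes := integralForm_wirtDz B
    (q := fun i z => (etaMinus D η' ν' i z * adj (h.coeff i z) (γ.coeff i z)).trace)
    (fun i => (SmoothMatOn.mul (hQ i) (hadj i)).trace) fun i j x hx => by
      have hT := B.isUnit_det_trans hx
      rw [γ.coeff_eq hx, ← h.compat i j x hx, adj_congr_frame hT, ← Matrix.mul_assoc,
        ← Matrix.mul_assoc, Matrix.trace_mul_comm, ← Matrix.mul_assoc, ← Matrix.mul_assoc,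
        ← etaMinus_compat D η' ν' i j x hx, Matrix.mul_nonsing_inv_cancel_right _ _ hT,
        Matrix.smul_mul, Matrix.trace_smul, smul_eq_mul]
  rw [← mul_zero (-Complex.I), ← hStokes, ← integralForm_const_mul]
  refine integralForm_congr B fun i z hz => ?_
  have hU := (B.chart i).open_target
  have d1 : MatDiffAt (etaMinus D η' ν' i) z := SmoothMatOn.matDiffAt (hQ i) hU hz
  have d2 : MatDiffAt (fun w => adj (h.coeff i w) (γ.coeff i w)) z :=
    SmoothMatOn.matDiffAt (hadj i) hU hz
  have e1 := adj_dbarEnd (α := D.coeff i) (h.posDef i z hz)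
    (SmoothMatOn.matDiffAt (h.smooth i) hU hz) (SmoothMatOn.matDiffAt (γ.smooth i) hU hz)
    (Filter.mem_of_superset (hU.mem_nhds hz) (h.posDef i)) d2
  have e2 := hgauge i z hz
  have e3 : delForm01 (D.coeff i) (h.coeff i) (etaMinus D η' ν' i) z = _ :=
    delForm01_sub (SmoothMatOn.matDiffAt (η'.smooth i) hU hz)
      (SmoothMatOn.matDiffAt (ν'.smoothFamily_dbarEnd D i) hU hz)
  have e4 : matDz (etaMinus D η' ν' i) z =
      -bracket0110 (adj (h.coeff i z) (φ.coeff i z)) (phiPlus φ φ' ν' i z) -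
        comm (chern10 (D.coeff i) (h.coeff i) z) (etaMinus D η' ν' i z) := by
    rw [← sub_eq_zero.1 e2, neg_sub, ← e3, delForm01, add_sub_cancel_right]
  have e5 := eq_sub_of_add_eq e1.symm
  rw [wirtDz_trace (d1.mul d2), matDz_mul d1 d2, e4, e5, ip01_add_ip10_eq]
  simp only [infAction, adj_neg, comm, adj_sub, adj_mul (h.posDef i z hz), bracket0110]
  generalize adj (h.coeff i z) (γ.coeff i z) = Y
  generalize adj (h.coeff i z) (φ.coeff i z) = F
  generalize etaMinus D η' ν' i z = Q
  generalize phiPlus φ φ' ν' i z = P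
  generalize chern10 (D.coeff i) (h.coeff i) z = β
  generalize adj (h.coeff i z) (dbarEnd (D.coeff i) (γ.coeff i) z) = W
  have t1 : (P * (Y * F)).trace = (F * P * Y).trace := by
    rw [← Matrix.mul_assoc, Matrix.trace_mul_comm, Matrix.mul_assoc]
  have t2 : (Q * (Y * β)).trace = (β * Q * Y).trace := by
    rw [← Matrix.mul_assoc, Matrix.trace_mul_comm, Matrix.mul_assoc]
  simp only [mul_sub, sub_mul, mul_neg, neg_mul, Matrix.trace_add, Matrix.trace_sub,
    Matrix.trace_neg, t1, t2, Matrix.mul_assoc]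
  ring

end Pairing

end HitchinMetric

namespace HitchinMetric

section Norm

variable {C : Type*} [TopologicalSpace C] [T2Space C] [CompactSpace C] [ChartedSpace ℂ C]
  [IsManifold 𝓘(ℂ) ω C] {n : ℕ} {ι : Type*} {B : SmoothBundle C n ι}
  {D : HolStructure B} {φ : Form10 B} {h : HermMetric B} {η' : Form01 B} {φ' : Form10 B}
  {ν' : EndSection B}

/-- The unitary deformation is in Coulomb gauge. -/
theorem perpToGauge_unitaryDeformation (h₀ : HermMetric B)
    (hgauge : SolvesGaugeEquation D φ h η' φ' ν') :
    PerpToGauge h₀ (unitaryDbar D h₀ h) (unitaryHiggs φ h₀ h)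
      (unitaryDeformation D φ h₀ h η' φ' ν') := by
  intro δ _
  have h1 : integralPairing h₀ (unitaryDeformation D φ h₀ h η' φ' ν')
      (infAction (unitaryDbar D h₀ h) (unitaryHiggs φ h₀ h) δ) = 0 := by
    rw [← integralPairing_infAction_eq_zero hgauge (h₀.conjSection h δ),
      ← integralPairing_conjPair h₀ h]
    exact integralPairing_congr h₀ (fun _ _ _ => ⟨rfl, rfl⟩) (pairEq_infAction D φ h₀ h δ)
  rw [gMetric, h1]
  simp

/-- The component perpendicular to the image of the infinitesimal action has the same norm as any
vector in Coulomb gauge. -/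
theorem gL2NormSq_unitaryDeformation (h₀ : HermMetric B)
    (hgauge : SolvesGaugeEquation D φ h η' φ' ν') :
    gL2NormSq h₀ (unitaryDbar D h₀ h) (unitaryHiggs φ h₀ h)
        (unitaryDeformation D φ h₀ h η' φ' ν') =
      2 * (integralPairing h (etaMinus D η' ν', phiPlus φ φ' ν')
        (etaMinus D η' ν', phiPlus φ φ' ν')).re := by
  set X₀ : FormPair ι n := (etaMinus D η' ν', phiPlus φ φ' ν')
  have sX₀ : SmoothFamily B X₀.1 ∧ SmoothFamily B X₀.2 :=
    ⟨smoothFamily_etaMinus D η' ν', smoothFamily_phiPlus φ φ' ν'⟩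
  have hperp := perpToGauge_unitaryDeformation h₀ hgauge
  have hex : ∃ γ : EndSection B, IsSU h₀ γ ∧ PerpToGauge h₀ (unitaryDbar D h₀ h)
      (unitaryHiggs φ h₀ h) (unitaryDeformation D φ h₀ h η' φ' ν' -
        infAction (unitaryDbar D h₀ h) (unitaryHiggs φ h₀ h) γ) := by
    refine ⟨⟨fun _ _ => 0, fun i a b => contDiffOn_const, fun i j x _ => by simp⟩,
      ⟨fun i z _ => by simp, fun i z _ => by simp [adj]⟩, ?_⟩
    have h0 : infAction (unitaryDbar D h₀ h) (unitaryHiggs φ h₀ h)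
        (⟨fun _ _ => 0, fun i a b => contDiffOn_const, fun i j x _ => by simp⟩ :
          EndSection B) = 0 := by
      refine Prod.ext ?_ ?_
      · funext i z
        simp [infAction, dbarEnd, matDzbar_const, comm]
      · funext i z
        simp [infAction, comm]
    rw [h0, sub_zero]
    exact hperp
  rw [gL2NormSq, dif_pos hex]
  obtain ⟨hsu, hγ⟩ := hex.choose_spec
  set γ := hex.choose
  set Z := infAction D.coeff φ.coeff (h₀.conjSection h γ)
  have sZ : SmoothFamily B Z.1 ∧ SmoothFamily B Z.2 := smooth_infAction D φ _
  have hXZ : integralPairing h X₀ Z = 0 := integralPairing_infAction_eq_zero hgauge _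
  have hZX : integralPairing h Z X₀ = 0 := by
    rw [← star_integralPairing, hXZ, star_zero]
  have eZ := pairEq_infAction D φ h₀ h γ
  have eW : PairEq B (unitaryDeformation D φ h₀ h η' φ' ν' -
      infAction (unitaryDbar D h₀ h) (unitaryHiggs φ h₀ h) γ) (h₀.conjPair h (X₀ - Z)) := by
    intro i z hz
    simp only [Prod.fst_sub, Prod.snd_sub, Pi.sub_apply, (eZ i z hz).1, (eZ i z hz).2,
      HermMetric.conjPair, mul_sub, sub_mul]
    exact ⟨rfl, rfl⟩
  have hZZ : (integralPairing h Z Z).re = 0 := by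
    have h1 := hγ γ hsu
    rw [gMetric, integralPairing_congr h₀ eW eZ, integralPairing_conjPair,
      integralPairing_sub_left h sX₀ sZ sZ, hXZ] at h1
    simpa using h1
  have sW : SmoothFamily B (X₀ - Z).1 ∧ SmoothFamily B (X₀ - Z).2 :=
    ⟨fun i => SmoothMatOn.sub (sX₀.1 i) (sZ.1 i), fun i => SmoothMatOn.sub (sX₀.2 i) (sZ.2 i)⟩
  rw [gMetric, integralPairing_congr h₀ eW eW, integralPairing_conjPair,
    integralPairing_sub_right h sW sX₀ sZ, integralPairing_sub_left h sX₀ sZ sX₀,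
    integralPairing_sub_left h sX₀ sZ sZ, hXZ, hZX]
  simp [hZZ]

/-- In Coulomb gauge one of the two arguments may be replaced by `(η̇, φ̇)`. -/
theorem integralPairing_self_eq (hgauge : SolvesGaugeEquation D φ h η' φ' ν') :
    integralPairing h (etaMinus D η' ν', phiPlus φ φ' ν')
        (etaMinus D η' ν', phiPlus φ φ' ν') =
      integralPairing h (etaMinus D η' ν', phiPlus φ φ' ν') (η'.coeff, φ'.coeff) := by
  have e : ((η'.coeff, φ'.coeff) : FormPair ι n) =
      (etaMinus D η' ν', phiPlus φ φ' ν') - infAction D.coeff φ.coeff ν' := by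
    refine Prod.ext ?_ ?_
    · funext i z
      simp [etaMinus, infAction]
    · funext i z
      simp [phiPlus, infAction]
  have sX : SmoothFamily B (etaMinus D η' ν') ∧ SmoothFamily B (phiPlus φ φ' ν') :=
    ⟨smoothFamily_etaMinus D η' ν', smoothFamily_phiPlus φ φ' ν'⟩
  rw [e, integralPairing_sub_right h sX sX (smooth_infAction D φ ν'),
    integralPairing_infAction_eq_zero hgauge, sub_zero]

end Norm

end HitchinMetric

theorem mainTheorem6 {C : Type*} [TopologicalSpace C] [T2Space C] [CompactSpace C]
    [ChartedSpace ℂ C] [IsManifold 𝓘(ℂ) ω C] {n : ℕ} {ι : Type*}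
    (B : HitchinMetric.SmoothBundle C n ι)
    -- a solution `(∂̄_E, φ, h)` of Hitchin's equations, and a background metric `h₀`
    (D : HitchinMetric.HolStructure B) (φ : HitchinMetric.Form10 B)
    (h h₀ : HitchinMetric.HermMetric B)
    (hHiggs : HitchinMetric.IsHiggsBundle D φ)
    (hHitchin : HitchinMetric.IsHarmonicMetric D φ h)
    -- a deformation `(η̇, φ̇)` of the Higgs bundle
    (η' : HitchinMetric.Form01 B) (φ' : HitchinMetric.Form10 B)
    (hdef : HitchinMetric.IsHiggsDeformation D φ η' φ')
    -- the metric deformation `ν̇`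
    (ν' : HitchinMetric.EndSection B) (hν : HitchinMetric.Traceless B ν'.coeff)
    (hgauge : HitchinMetric.SolvesGaugeEquation D φ h η' φ' ν') :
    -- the associated unitary deformation is in Coulomb gauge, and the formula holds
    HitchinMetric.PerpToGauge h₀ (HitchinMetric.unitaryDbar D h₀ h)
        (HitchinMetric.unitaryHiggs φ h₀ h)
        (HitchinMetric.unitaryDeformation D φ h₀ h η' φ' ν') ∧
    ((HitchinMetric.gL2NormSq h₀ (HitchinMetric.unitaryDbar D h₀ h)
        (HitchinMetric.unitaryHiggs φ h₀ h)
        (HitchinMetric.unitaryDeformation D φ h₀ h η' φ' ν') : ℝ) : ℂ) =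
      2 * HitchinMetric.integralPairing h
        (HitchinMetric.etaMinus D η' ν', HitchinMetric.phiPlus φ φ' ν')
        (η'.coeff, φ'.coeff) := by
  refine ⟨HitchinMetric.perpToGauge_unitaryDeformation h₀ hgauge, ?_⟩
  rw [HitchinMetric.gL2NormSq_unitaryDeformation h₀ hgauge,
    ← HitchinMetric.integralPairing_self_eq hgauge, Complex.ofReal_mul, Complex.ofReal_ofNat,
    Complex.conj_eq_iff_re.1 (HitchinMetric.star_integralPairing h _ _)]
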